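/- Let $d,N\ge 0$ be integers, let $R\subset\mathbb R^d$ be a measurable set which contains $\mathbf 0$ as an interior point, and let $f\in C^{N+2}(R)$ and $g\in C^N(R)$ be real-valued. Suppose that $f$ has a unique minimum, of value $0$, at $\mathbf 0$, that $f$ is otherwise bounded away from $0$ (for every $\delta>0$ there is $c>0$ such that $f(\mathbf x)\ge c$ for all $\mathbf x\in R$ with $|\mathbf x|\ge\delta$), and that the minimum is nondegenerate, i.e. the Hessian matrix $H_xf(\mathbf 0)$ is invertible. Suppose that for some $k_0>0$ the integral $\int_R e^{-k_0f}g\,d^d\mathbf x$ converges (absolutely). Then $\int_R e^{-kf}g\,d^d\mathbf x$ converges absolutely for all $k\ge k_0$, there exists an invertible linear transformation $P:\mathbb R^d\to\mathbb R^d$ such that in the coordinates $\mathbf y=P\mathbf x$ the Hessian of $f$ at $\mathbf 0$ is $H_yf(\mathbf 0)=\mathbf 1$, and for every such $P$, as $k\to\infty$, $$\int_R e^{-kf}g\,d^d\mathbf x=k^{-d/2}\sum_{j=0}^{\lfloor N/2\rfloor}\zeta_{2j}k^{-j}+O\bigl(k^{-(N+d)/2+1}\bigr),$$ where the remainder is moreover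 $o(k^{-(N+d)/2})$. Here, for every integer $s\ge 0$, $$\zeta_s=\frac{(2\pi)^{d/2}}{\sqrt{\det H_xf(\mathbf 0)}}\sum_{m=0}^{s}\sum_{r=0}^{m}\frac{(-1)^r}{r!}\sum_{|\beta|=s-m}\ \sum_{\substack{n_1+\cdots+n_r=m\\ n_i\ge 1}}\ \sum_{|\alpha_1|=n_1+2}\cdots\sum_{|\alpha_r|=n_r+2}\operatorname{even}(\beta+\alpha_1+\cdots+\alpha_r)\,\frac{(\beta+\alpha_1+\cdots+\alpha_r-\mathbf 1)!!}{\beta!\,\alpha_1!\cdots\alpha_r!}\,D_y^\beta g(\mathbf 0)\,D_y^{\alpha_1}f(\mathbf 0)\cdots D_y^{\alpha_r}f(\mathbf 0),$$ and $\zeta_s=0$ for all odd $s$. In this formula $\beta,\alpha_1,\dots,\alpha_r$ run over multi-indices in $\mathbb Z_{\ge0}^d$; the term $r=0$ occurs only for $m=0$, where it equals $\sum_{|\beta|=s}\operatorname{even}(\beta)\frac{(\beta-\mathbf 1)!!}{\beta!}D_y^\beta g(\mathbf 0)$ (for $m>0$ there is no empty tuple $(n_1,\dots,n_r)$ with sum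 $m$); for a multi-index $\alpha=(\alpha^1,\dots,\alpha^d)$, $|\alpha|=\sum_i\alpha^i$, $\alpha!=\prod_i\alpha^i!$, $(\alpha-\mathbf 1)!!=\prod_i(\alpha^i-1)!!$ with $(-1)!!=0!!=1$, $D_y^\alpha$ is the mixed partial derivative of order $\alpha$ with respect to $\mathbf y$, and $\operatorname{even}(\alpha)$ is $0$ if some $\alpha^i$ is odd and $1$ otherwise. -/

import Mathlib

open scoped Nat

noncomputable section

namespace LaplaceExpansion

variable {d : ℕ}

/-- The Hessian matrix of `f` at the point `x`, with entries `∂ᵢ ∂ⱼ f (x)`. -/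
def hessian (f : EuclideanSpace ℝ (Fin d) → ℝ) (x : EuclideanSpace ℝ (Fin d)) :
    Matrix (Fin d) (Fin d) ℝ :=
  Matrix.of fun i j => iteratedFDeriv ℝ 2 f x
    ![EuclideanSpace.single i (1 : ℝ), EuclideanSpace.single j (1 : ℝ)]

/-- The mixed partial derivative `D^α h (x)`, where `α` is a multi-index: the derivative of `h` of
order `|α| = ∑ i, α i` at `x`, evaluated at the standard basis vectors, the `i`-th one being
repeated `α i` times. -/
def mixedPartial (α : Fin d → ℕ) (h : EuclideanSpace ℝ (Fin d) → ℝ)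
    (x : EuclideanSpace ℝ (Fin d)) : ℝ :=
  iteratedFDeriv ℝ (∑ i, α i) h x
    fun l => EuclideanSpace.single (finSigmaFinEquiv.symm l).1 (1 : ℝ)

/-- The finite set of multi-indices `α` in `d` variables with `|α| = n`. -/
def multiIndices (d n : ℕ) : Finset (Fin d → ℕ) :=
  Finset.univ.piAntidiag n

/-- The finite set of ordered tuples `(n₁, …, n_r)` of integers `nᵢ ≥ 1` with
`n₁ + ⋯ + n_r = m`. For `r = 0` it consists of the empty tuple if `m = 0`, and is empty if
`m > 0`. -/
def compositions (r m : ℕ) : Finset (Fin r → ℕ) :=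
  (Finset.univ.piAntidiag m).filter fun n => ∀ i, 1 ≤ n i

/-- The multi-index factorial `α! = α¹! ⋯ αᵈ!`. -/
def multiFactorial (α : Fin d → ℕ) : ℕ := ∏ i, (α i)!

/-- `(α - 𝟏)!! = (α¹ - 1)!! ⋯ (αᵈ - 1)!!` with `(-1)!! = 1` (a component `α i = 0` contributes
`(0 - 1)!! = 0!! = 1` in natural number arithmetic, which is the same value). -/
def doubleFactorialSubOne (α : Fin d → ℕ) : ℕ := ∏ i, (α i - 1)‼

open scoped Classical in
/-- `even α` is `0` if some component of `α` is odd, and `1` otherwise. -/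
def even (α : Fin d → ℕ) : ℝ := if ∀ i, Even (α i) then 1 else 0

/-- The coefficient `ζ_s` for the coordinates `y = P x`. Derivatives with respect to `y` are
derivatives of `f ∘ P⁻¹` and `g ∘ P⁻¹`.

The summation over `r` starts at `0`. The term `r = 0` occurs only for `m = 0`, where it is
`∑_{|β| = s} even(β) (β - 𝟏)!! / β! D^β g`; for `m > 0` it is zero because `compositions 0 m` is
empty, and `r` effectively runs from `1` to `m`. -/
def coeff (f g : EuclideanSpace ℝ (Fin d) → ℝ)
    (P : EuclideanSpace ℝ (Fin d) ≃L[ℝ] EuclideanSpace ℝ (Fin d)) (s : ℕ) : ℝ :=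
  (2 * Real.pi) ^ ((d : ℝ) / 2) / √(hessian f 0).det *
    ∑ m ∈ Finset.range (s + 1), ∑ r ∈ Finset.range (m + 1), ((-1 : ℝ) ^ r / (r ! : ℝ)) *
      ∑ β ∈ multiIndices d (s - m), ∑ n ∈ compositions r m,
        ∑ α ∈ Fintype.piFinset (fun i : Fin r => multiIndices d (n i + 2)),
          even (β + ∑ i, α i) *
            ((doubleFactorialSubOne (β + ∑ i, α i) : ℝ) /
              ((multiFactorial β : ℝ) * ∏ i, (multiFactorial (α i) : ℝ))) *
            (mixedPartial β (g ∘ P.symm) 0 * ∏ i, mixedPartial (α i) (f ∘ P.symm) 0)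

end LaplaceExpansion

end

open scoped Topology
open Filter Asymptotics

/-! This is Laplace's method. Put `t = k ^ (-1/2)`, `F = f ∘ P⁻¹`, `G = g ∘ P⁻¹`. Away from `0` the
phase is at least some `c > 0`, so that part of the integral is `O(exp (-k c))` and beats every
power of `k`. Near `0`, substituting `x = P⁻¹ (t z)` turns the integral into `|det P⁻¹| t ^ d ∫ exp
(-F(t z) / t²) G(t z) dz` over `t ‖z‖ < δ`.

As `F` has value `0`, gradient `0` and Hessian `1` at the origin, `F(t z) / t² = ‖z‖² / 2 + u(t,
z)`, where `u` has an expansion in powers of `t` without constant term whose coefficients are the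
Taylor terms of `F` of degree at least 3. Hence `exp (-u)` may be replaced by its exponential series
up to `u ^ N`, and multiplication by the Taylor expansion of `G` gives an expansion of the integrand
up to `o(t ^ N)` at each fixed `z`. A small enough `δ` gives `|u| ≤ ‖z‖² / 4`, so the error divided
by `t ^ N` is dominated by a polynomial times `exp (-‖z‖² / 4)`, and dominated convergence carries
the expansion through the integral (`isLittleO_integral_scaled`). With only finitely many
derivatives the Taylor remainder is of Peano type, which is why the error is `o` of the last order.

The coefficients are Gaussian moments of products of Taylor polynomials. The symmetry of iterated
derivatives rewrites these polynomials by multi-indices (`iteratedFDeriv_diag_eq_sum_mixedPartial`),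
and the moments give the double factorials (`integral_gaussian_mul_coeff_expNegMul`). The Jacobian
supplies `1 / √(det H)`, because `Lᵀ H L = 1` for `L = P⁻¹`. Odd coefficients vanish by parity. -/

theorem WithTop.natCast_ne_infty (n : ℕ) : (n : WithTop ℕ∞) ≠ ((⊤ : ℕ∞) : WithTop ℕ∞) := by simp

/-! ### Taylor's formula with Peano remainder -/

/-- The integral remainder involves the derivative of top order along the segment. Subtracting the
same integral with that derivative frozen at `x` produces the top Taylor term, and continuity of the
derivative makes the difference small. -/
theorem taylor_isLittleO_iteratedFDeriv {E : Type*} [NormedAddCommGroup E] [NormedSpace ℝ E]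
    {h : E → ℝ} {x : E} {n : ℕ} (hh : ContDiffAt ℝ n h x) :
    (fun y => h (x + y) - ∑ k ∈ Finset.range (n + 1),
      (k ! : ℝ)⁻¹ * iteratedFDeriv ℝ k h x (fun _ => y)) =o[𝓝 0] fun y => ‖y‖ ^ n := by
  rcases n with _ | n
  · have hc : Tendsto (fun y => h (x + y)) (𝓝 0) (𝓝 (h x)) := by
      have : ContinuousAt (fun y => h (x + y)) 0 := by
        refine ContinuousAt.comp (g := h) ?_ (by fun_prop)
        simpa using hh.continuousAt
      simpa [ContinuousAt] using this
    simp only [pow_zero, isLittleO_one_iff, zero_add, Finset.range_one, Finset.sum_singleton,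
      Nat.factorial_zero, Nat.cast_one, inv_one, one_mul, iteratedFDeriv_zero_apply]
    simpa using hc.sub_const (h x)
  · rw [isLittleO_iff]
    intro c hc
    have h1 : ∀ᶠ z in 𝓝 x, ContDiffAt ℝ ((n + 1 : ℕ) : WithTop ℕ∞) h z :=
      hh.eventually (by simp)
    have h2 : ContinuousAt (iteratedFDeriv ℝ (n + 1) h) x :=
      (hh.iteratedFDeriv_right (i := n + 1) (m := 0) (by simp)).continuousAt
    have h3 : ∀ᶠ z in 𝓝 x, ‖iteratedFDeriv ℝ (n + 1) h z - iteratedFDeriv ℝ (n + 1) h x‖ < c := by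
      have := (Metric.tendsto_nhds.1 h2.tendsto) c hc
      simpa [dist_eq_norm] using this
    obtain ⟨r, hr, hball⟩ := Metric.eventually_nhds_iff_ball.1 (h1.and h3)
    filter_upwards [Metric.ball_mem_nhds (0 : E) hr] with y hy
    have hmem : ∀ t ∈ Set.Icc (0 : ℝ) 1, x + t • y ∈ Metric.ball x r := by
      intro t ht
      rw [mem_ball_zero_iff] at hy
      rw [Metric.mem_ball, dist_eq_norm, add_sub_cancel_left, norm_smul, Real.norm_of_nonneg ht.1]
      nlinarith [norm_nonneg y, ht.2]
    have key := map_add_eq_sum_add_integral_iteratedFDeriv (f := h) (x := x) (y := y) (n := n)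
      (fun t ht => by exact_mod_cast (hball _ (hmem t ht)).1)
    have hcont : ContinuousOn (fun t : ℝ => (1 - t) ^ n •
        iteratedFDeriv ℝ (n + 1) h (x + t • y) (fun _ => y)) (Set.uIcc 0 1) := by
      rw [Set.uIcc_of_le zero_le_one]
      intro t ht
      have hc : ContinuousAt (iteratedFDeriv ℝ (n + 1) h) (x + t • y) :=
        ((hball _ (hmem t ht)).1.iteratedFDeriv_right (i := n + 1) (m := 0)
          (by simp)).continuousAt
      have hc' : ContinuousWithinAt (fun t : ℝ => iteratedFDeriv ℝ (n + 1) h (x + t • y)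
          (fun _ => y)) (Set.Icc 0 1) t :=
        (ContinuousAt.comp (x := t) (f := fun t : ℝ => x + t • y) hc
          (by fun_prop)).continuousWithinAt.eval_const _
      have hp : Continuous fun t : ℝ => (1 - t) ^ n := by fun_prop
      exact hp.continuousWithinAt.smul hc'
    have hpow : ∫ t in (0 : ℝ)..1, (1 - t) ^ n = ((n : ℝ) + 1)⁻¹ := by
      rw [intervalIntegral.integral_comp_sub_left (fun t => t ^ n) 1]
      simp
    have hconst : ∫ t in (0 : ℝ)..1, (1 - t) ^ n • iteratedFDeriv ℝ (n + 1) h x (fun _ => y) =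
        ((n : ℝ) + 1)⁻¹ * iteratedFDeriv ℝ (n + 1) h x (fun _ => y) := by
      rw [intervalIntegral.integral_smul_const, hpow, smul_eq_mul]
    -- Since `∫ (1 - t) ^ n = 1 / (n + 1)`, the frozen integral divided by `n!` is exactly the
    -- Taylor term of degree `n + 1`.
    have hdiff : h (x + y) - ∑ k ∈ Finset.range (n + 1 + 1),
        (k ! : ℝ)⁻¹ * iteratedFDeriv ℝ k h x (fun _ => y) =
        (n ! : ℝ)⁻¹ * ∫ t in (0 : ℝ)..1, ((1 - t) ^ n •
          iteratedFDeriv ℝ (n + 1) h (x + t • y) (fun _ => y) -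
          (1 - t) ^ n • iteratedFDeriv ℝ (n + 1) h x (fun _ => y)) := by
      rw [intervalIntegral.integral_sub hcont.intervalIntegrable
        (Continuous.intervalIntegrable (by fun_prop) _ _), hconst, key,
        Finset.sum_range_succ _ (n + 1), Nat.factorial_succ]
      simp only [smul_eq_mul]
      push_cast
      rw [mul_inv]
      ring
    have hbound : ‖∫ t in (0 : ℝ)..1, ((1 - t) ^ n •
          iteratedFDeriv ℝ (n + 1) h (x + t • y) (fun _ => y) -
          (1 - t) ^ n • iteratedFDeriv ℝ (n + 1) h x (fun _ => y))‖ ≤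
        c * ‖y‖ ^ (n + 1) * |1 - 0| := by
      refine intervalIntegral.norm_integral_le_of_norm_le_const fun t ht => ?_
      rw [Set.uIoc_of_le zero_le_one] at ht
      rw [← smul_sub, norm_smul, ← sub_apply]
      have e1 : ‖(1 - t) ^ n‖ ≤ 1 := by
        rw [norm_pow, Real.norm_of_nonneg (by linarith [ht.2])]
        exact pow_le_one₀ (by linarith [ht.2]) (by linarith [ht.1])
      have e2 := (iteratedFDeriv ℝ (n + 1) h (x + t • y) -
        iteratedFDeriv ℝ (n + 1) h x).le_opNorm (fun _ => y)
      rw [Finset.prod_const, Finset.card_univ, Fintype.card_fin] at e2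
      have e3 := (hball _ (hmem t ⟨ht.1.le, ht.2⟩)).2.le
      calc _ ≤ 1 * (c * ‖y‖ ^ (n + 1)) := by
            gcongr
            exact e2.trans (by gcongr)
        _ = _ := one_mul _
    rw [hdiff, norm_mul, norm_pow, norm_norm]
    have e4 : ‖(n ! : ℝ)⁻¹‖ ≤ 1 := by
      rw [norm_inv, Real.norm_natCast]
      exact inv_le_one_of_one_le₀ (by exact_mod_cast Nat.factorial_pos n)
    calc _ ≤ 1 * (c * ‖y‖ ^ (n + 1) * |1 - 0|) := by gcongr
      _ = _ := by simp

/-! ### Symmetry of iterated derivatives of finite smoothness -/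

section Symmetry

variable {E F : Type*} [NormedAddCommGroup E] [NormedSpace ℝ E]
  [NormedAddCommGroup F] [NormedSpace ℝ F] {f : E → F}

/-- Isolates the first two slots as a second derivative, so that Schwarz's theorem applies to them.
-/
theorem ContDiffAt.iteratedFDeriv_add_two_apply {x : E} {n : ℕ}
    (hf : ContDiffAt ℝ ((n + 2 : ℕ) : WithTop ℕ∞) f x) (v : Fin (n + 2) → E) :
    iteratedFDeriv ℝ (n + 2) f x v =
      fderiv ℝ (fderiv ℝ fun z => iteratedFDeriv ℝ n f z (Fin.tail (Fin.tail v))) x (v 0) (v 1) := by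
  have hd : ContDiffAt ℝ 2 (fun z => iteratedFDeriv ℝ n f z (Fin.tail (Fin.tail v))) x := by
    have := hf.iteratedFDeriv_right (i := n) (m := 2) (by norm_cast; omega)
    exact (ContinuousMultilinearMap.apply ℝ (fun _ : Fin n => E) F
      (Fin.tail (Fin.tail v))).contDiff.contDiffAt.comp x this
  have hfd : DifferentiableAt ℝ
      (fderiv ℝ fun z => iteratedFDeriv ℝ n f z (Fin.tail (Fin.tail v))) x :=
    (hd.fderiv_right (m := 1) (by norm_num)).differentiableAt (by simp)
  have h1 : DifferentiableAt ℝ (iteratedFDeriv ℝ (n + 1) f) x :=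
    hf.differentiableAt_iteratedFDeriv (by norm_cast; omega)
  rw [h1.iteratedFDeriv_succ_apply_left']
  have h2 : (fun y => iteratedFDeriv ℝ (n + 1) f y (Fin.tail v)) =ᶠ[𝓝 x]
      fun y => fderiv ℝ (fun z => iteratedFDeriv ℝ n f z (Fin.tail (Fin.tail v))) y (v 1) := by
    filter_upwards [hf.eventually (WithTop.natCast_ne_infty _)] with y hy
    have h3 : DifferentiableAt ℝ (iteratedFDeriv ℝ n f) y :=
      hy.differentiableAt_iteratedFDeriv (by norm_cast; omega)
    rw [h3.iteratedFDeriv_succ_apply_left']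
    rfl
  rw [h2.fderiv_eq, fderiv_clm_apply hfd (by fun_prop)]
  simp

/-- Exchanging the first two slots is Schwarz's theorem. A later exchange leaves the first slot
alone: the identity one order lower holds at all nearby points, and can be differentiated in the
direction of the first slot. -/
theorem ContDiffAt.iteratedFDeriv_comp_adjacent_swap {n : ℕ} (i : Fin n) {x : E}
    (hf : ContDiffAt ℝ ((n + 1 : ℕ) : WithTop ℕ∞) f x) (v : Fin (n + 1) → E) :
    iteratedFDeriv ℝ (n + 1) f x (v ∘ Equiv.swap i.castSucc i.succ) =
      iteratedFDeriv ℝ (n + 1) f x v := by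
  induction n generalizing x with
  | zero => exact i.elim0
  | succ n ih =>
    cases i using Fin.cases with
    | zero =>
      rw [hf.iteratedFDeriv_add_two_apply, hf.iteratedFDeriv_add_two_apply]
      have ht : Fin.tail (Fin.tail (v ∘ Equiv.swap (Fin.castSucc 0) (Fin.succ 0))) =
          Fin.tail (Fin.tail v) := by
        funext l
        simp only [Fin.tail, Function.comp_apply]
        rw [Equiv.swap_apply_of_ne_of_ne (by simp [Fin.ext_iff]) (by simp [Fin.ext_iff])]
      have h0 : (v ∘ Equiv.swap (Fin.castSucc 0) (Fin.succ 0)) 0 = v 1 := by simp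
      have h1 : (v ∘ Equiv.swap (Fin.castSucc 0) (Fin.succ 0)) 1 = v 0 := by simp
      rw [ht, h0, h1]
      have hd : ContDiffAt ℝ 2 (fun z => iteratedFDeriv ℝ n f z (Fin.tail (Fin.tail v))) x := by
        have := hf.iteratedFDeriv_right (i := n) (m := 2) (by norm_cast; omega)
        exact (ContinuousMultilinearMap.apply ℝ (fun _ : Fin n => E) F
          (Fin.tail (Fin.tail v))).contDiff.contDiffAt.comp x this
      exact hd.isSymmSndFDerivAt (by simp) _ _
    | succ j =>
      have h1 : DifferentiableAt ℝ (iteratedFDeriv ℝ (n + 1) f) x :=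
        hf.differentiableAt_iteratedFDeriv (by norm_cast; omega)
      rw [h1.iteratedFDeriv_succ_apply_left', h1.iteratedFDeriv_succ_apply_left']
      have h0 : (v ∘ Equiv.swap j.succ.castSucc j.succ.succ) 0 = v 0 := by
        rw [Function.comp_apply, Equiv.swap_apply_of_ne_of_ne] <;> simp [Fin.ext_iff]
      have ht : Fin.tail (v ∘ Equiv.swap j.succ.castSucc j.succ.succ) =
          Fin.tail v ∘ Equiv.swap j.castSucc j.succ := by
        funext l
        simp only [Fin.tail, Function.comp_apply, Fin.castSucc_succ, Equiv.swap_apply_def,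
          Fin.succ_inj]
        split_ifs <;> rfl
      rw [h0, ht]
      congr 1
      refine Filter.EventuallyEq.fderiv_eq ?_
      filter_upwards [hf.eventually (WithTop.natCast_ne_infty _)] with y hy
      exact ih j (hy.of_le (by norm_cast; omega)) _

/-- Adjacent transpositions generate the symmetric group. -/
theorem ContDiffAt.iteratedFDeriv_comp_perm_of_natCast {n : ℕ} {x : E}
    (hf : ContDiffAt ℝ (n : WithTop ℕ∞) f x) (v : Fin n → E) (σ : Equiv.Perm (Fin n)) :
    iteratedFDeriv ℝ n f x (v ∘ σ) = iteratedFDeriv ℝ n f x v := by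
  rcases n with _ | n
  · congr 1
    exact Subsingleton.elim _ _
  · have hσ : σ ∈ Submonoid.closure
        (Set.range fun i : Fin n => Equiv.swap i.castSucc i.succ) := by
      rw [Equiv.Perm.mclosure_swap_castSucc_succ]
      trivial
    induction hσ using Submonoid.closure_induction generalizing v with
    | mem τ hτ =>
      obtain ⟨i, rfl⟩ := hτ
      exact hf.iteratedFDeriv_comp_adjacent_swap i v
    | one => rfl
    | mul τ ρ _ _ h1 h2 => exact (h2 (v ∘ τ)).trans (h1 v)

end Symmetry

/-! ### Taylor polynomials in multi-index form -/

section MultiIndex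

open LaplaceExpansion

/-- Bijections between corresponding fibers glue to a permutation. -/
theorem Equiv.Perm.exists_comp_eq_of_card_fiber_eq {α ι : Type*} [Fintype α] [DecidableEq ι]
    {p q : α → ι}
    (h : ∀ i, (Finset.univ.filter fun a => p a = i).card =
      (Finset.univ.filter fun a => q a = i).card) :
    ∃ σ : Equiv.Perm α, p = q ∘ σ := by
  have e : ∀ i, Nonempty ({a // p a = i} ≃ {a // q a = i}) := fun i => by
    rw [← Fintype.card_eq, Fintype.card_subtype, Fintype.card_subtype]
    exact h i
  let σ : Equiv.Perm α := (Equiv.sigmaFiberEquiv p).symm.trans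
    ((Equiv.sigmaCongrRight fun i => (e i).some).trans (Equiv.sigmaFiberEquiv q))
  refine ⟨σ, funext fun a => ?_⟩
  exact ((e (p a)).some ⟨a, rfl⟩).2.symm

theorem MvPolynomial.prod_X_comp {α ι R : Type*} [Fintype α] [Fintype ι] [DecidableEq ι]
    [CommSemiring R] (p : α → ι) :
    ∏ a, (MvPolynomial.X (p a) : MvPolynomial ι R) =
      MvPolynomial.monomial
        (Finsupp.equivFunOnFinite.symm fun i => (Finset.univ.filter fun a => p a = i).card) 1 := by
  rw [MvPolynomial.monomial_eq, Finsupp.prod_fintype _ _ (by simp)]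
  simp only [map_one, one_mul, Finsupp.equivFunOnFinite_symm_apply_apply]
  rw [← Finset.prod_fiberwise Finset.univ p]
  refine Finset.prod_congr rfl fun i _ => ?_
  rw [Finset.prod_congr rfl (g := fun _ => MvPolynomial.X i) (fun a ha => by
    rw [(Finset.mem_filter.1 ha).2]), Finset.prod_const]

/-- Both numbers are the coefficient of the monomial `α` in `(∑ X i) ^ n`, expanded once over words
and once by the multinomial theorem. -/
theorem card_filter_card_fiber_eq_multinomial {d n : ℕ} (α : Fin d → ℕ) (hα : ∑ i, α i = n) :
    (Finset.univ.filter fun p : Fin n → Fin d =>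
      (fun i => (Finset.univ.filter fun l => p l = i).card) = α).card =
      Nat.multinomial Finset.univ α := by
  have h := (Fintype.sum_pow (fun i => (MvPolynomial.X i : MvPolynomial (Fin d) ℕ)) n).symm.trans
    (Finset.sum_pow_eq_sum_piAntidiag Finset.univ _ n)
  have h' := congrArg (MvPolynomial.coeff (Finsupp.equivFunOnFinite.symm α)) h
  simp only [MvPolynomial.coeff_sum, MvPolynomial.prod_X_comp, MvPolynomial.coeff_monomial,
    EmbeddingLike.apply_eq_iff_eq] at h'
  rw [Finset.card_filter, h']
  have hk : ∀ k : Fin d → ℕ, MvPolynomial.coeff (Finsupp.equivFunOnFinite.symm α)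
      ((Nat.multinomial Finset.univ k : MvPolynomial (Fin d) ℕ) *
        ∏ i, MvPolynomial.X i ^ k i) =
      if k = α then Nat.multinomial Finset.univ k else 0 := by
    intro k
    have hX : ∏ i, (MvPolynomial.X i : MvPolynomial (Fin d) ℕ) ^ k i =
        MvPolynomial.monomial (Finsupp.equivFunOnFinite.symm k) 1 := by
      rw [MvPolynomial.monomial_eq, Finsupp.prod_fintype _ _ (by simp)]
      simp
    rw [hX, ← map_natCast (MvPolynomial.C (σ := Fin d) (R := ℕ)), MvPolynomial.coeff_C_mul,
      MvPolynomial.coeff_monomial]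
    simp only [EmbeddingLike.apply_eq_iff_eq]
    split_ifs <;> simp
  rw [Finset.sum_congr rfl fun k _ => hk k, Finset.sum_ite_eq', if_pos]
  simp [Finset.mem_piAntidiag, hα]

variable {d : ℕ} {h : EuclideanSpace ℝ (Fin d) → ℝ} {x : EuclideanSpace ℝ (Fin d)}

theorem card_filter_finSigmaFinEquiv_symm_fst {d : ℕ} (α : Fin d → ℕ) (i : Fin d) :
    (Finset.univ.filter fun l : Fin (∑ i, α i) => (finSigmaFinEquiv.symm l).1 = i).card = α i := by
  rw [← Fintype.card_subtype]
  have e : {l : Fin (∑ i, α i) // (finSigmaFinEquiv.symm l).1 = i} ≃ Fin (α i) :=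
    (finSigmaFinEquiv.symm.subtypeEquiv (p := fun l => (finSigmaFinEquiv.symm l).1 = i)
      (q := fun s => s.1 = i) fun _ => Iff.rfl).trans
      (Equiv.sigmaSubtype i)
  rw [Fintype.card_congr e, Fintype.card_fin]

/-- `mixedPartial` uses the sorted word of basis vectors; any word with the same letter counts is a
permutation of it. -/
theorem iteratedFDeriv_single_eq_mixedPartial {n : ℕ} (hh : ContDiffAt ℝ n h x)
    (p : Fin n → Fin d) (α : Fin d → ℕ) (hα : ∑ i, α i = n)
    (hp : (fun i => (Finset.univ.filter fun l => p l = i).card) = α) :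
    iteratedFDeriv ℝ n h x (fun l => EuclideanSpace.single (p l) (1 : ℝ)) =
      mixedPartial α h x := by
  subst hα
  obtain ⟨σ, hσ⟩ := Equiv.Perm.exists_comp_eq_of_card_fiber_eq
    (p := p) (q := fun l => (finSigmaFinEquiv.symm l).1) fun i => by
      rw [card_filter_finSigmaFinEquiv_symm_fst]
      exact congrFun hp i
  rw [hσ]
  exact hh.iteratedFDeriv_comp_perm_of_natCast
    (fun l => EuclideanSpace.single (finSigmaFinEquiv.symm l).1 (1 : ℝ)) σ

theorem EuclideanSpace.sum_smul_single (y : EuclideanSpace ℝ (Fin d)) :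
    ∑ i, y i • EuclideanSpace.single i (1 : ℝ) = y := by
  simpa using (EuclideanSpace.basisFun (Fin d) ℝ).sum_repr y

/-- Multilinear expansion of `y = ∑ y i • e i` gives a sum over words. By symmetry each summand
depends only on its letter counts `α`, and `n! / α!` words share them. -/
theorem iteratedFDeriv_diag_eq_sum_mixedPartial {n : ℕ} (hh : ContDiffAt ℝ n h x)
    (y : EuclideanSpace ℝ (Fin d)) :
    (n ! : ℝ)⁻¹ * iteratedFDeriv ℝ n h x (fun _ => y) =
      ∑ α ∈ multiIndices d n, mixedPartial α h x / multiFactorial α * ∏ i, y i ^ α i := by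
  have h1 : iteratedFDeriv ℝ n h x (fun _ => y) =
      ∑ p : Fin n → Fin d, (∏ i, y i ^ (Finset.univ.filter fun l => p l = i).card) *
        mixedPartial (fun i => (Finset.univ.filter fun l => p l = i).card) h x := by
    conv_lhs => rw [← EuclideanSpace.sum_smul_single y]
    rw [ContinuousMultilinearMap.map_sum]
    refine Finset.sum_congr rfl fun p _ => ?_
    rw [ContinuousMultilinearMap.map_smul_univ, smul_eq_mul,
      iteratedFDeriv_single_eq_mixedPartial hh p _ ?_ rfl, ← Finset.prod_fiberwise Finset.univ p]
    · congr 1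
      refine Finset.prod_congr rfl fun i _ => ?_
      rw [Finset.prod_congr rfl (g := fun _ => y i) (fun a ha => by
        rw [(Finset.mem_filter.1 ha).2]), Finset.prod_const]
    · rw [← Finset.card_eq_sum_card_fiberwise (fun _ _ => Finset.mem_univ _)]
      simp
  have hmaps : ∀ p ∈ (Finset.univ : Finset (Fin n → Fin d)),
      (fun i => (Finset.univ.filter fun l => p l = i).card) ∈ multiIndices d n := by
    intro p _
    rw [multiIndices, Finset.mem_piAntidiag]
    refine ⟨?_, by simp⟩
    rw [← Finset.card_eq_sum_card_fiberwise (fun _ _ => Finset.mem_univ _)]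
    simp
  rw [h1, ← Finset.sum_fiberwise_of_maps_to hmaps, Finset.mul_sum]
  refine Finset.sum_congr rfl fun α hα => ?_
  have hsum : ∑ i, α i = n := (Finset.mem_piAntidiag.1 hα).1
  rw [Finset.sum_congr rfl (g := fun _ => (∏ i, y i ^ α i) * mixedPartial α h x) (fun p hp => by
    have hp' := (Finset.mem_filter.1 hp).2
    rw [hp', ← hp']), Finset.sum_const, card_filter_card_fiber_eq_multinomial α hsum, nsmul_eq_mul]
  have hm : (multiFactorial α : ℝ) * Nat.multinomial Finset.univ α = n ! := by
    rw [multiFactorial, ← hsum]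
    exact_mod_cast Nat.multinomial_spec Finset.univ α
  have hα0 : (multiFactorial α : ℝ) ≠ 0 := by
    rw [multiFactorial]
    exact_mod_cast (Finset.prod_pos fun i _ => Nat.factorial_pos (α i)).ne'
  have hn : (n ! : ℝ) ≠ 0 := by positivity
  field_simp
  rw [← hm]
  ring

end MultiIndex

/-! ### Gaussian moments and Gaussian domination -/

section GaussianMoments

open MeasureTheory LaplaceExpansion

theorem integrable_pow_mul_exp_neg_sq_div_two (n : ℕ) :
    Integrable fun x : ℝ => x ^ n * Real.exp (-(x ^ 2 / 2)) := by
  have h := integrable_rpow_mul_exp_neg_mul_sq (b := 1 / 2) (by norm_num) (s := n)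
    (by have : (0 : ℝ) ≤ n := n.cast_nonneg
        linarith)
  refine h.congr (Eventually.of_forall fun x => ?_)
  simp only [Real.rpow_natCast]
  congr 2
  ring

theorem hasDerivAt_exp_neg_sq_div_two (x : ℝ) :
    HasDerivAt (fun x : ℝ => Real.exp (-(x ^ 2 / 2))) (-(x * Real.exp (-(x ^ 2 / 2)))) x := by
  have h : HasDerivAt (fun x : ℝ => -(x ^ 2 / 2)) (-x) x := by
    exact ((hasDerivAt_pow 2 x).div_const 2).neg.congr_deriv (by simp)
  exact h.exp.congr_deriv (by ring)

/-- The derivative of `x ^ (n + 1) * exp (-x² / 2)` has integral zero, so the moments satisfy `M (n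
+ 2) = (n + 1) M n`. -/
theorem integral_pow_mul_exp_neg_sq_div_two (n : ℕ) :
    ∫ x : ℝ, x ^ n * Real.exp (-(x ^ 2 / 2)) =
      if Even n then √(2 * Real.pi) * ((n - 1)‼ : ℝ) else 0 := by
  induction n using Nat.twoStepInduction with
  | zero =>
    have h := integral_gaussian (1 / 2)
    simp only [pow_zero, one_mul, Even.zero, if_true, zero_tsub, Nat.doubleFactorial, Nat.cast_one,
      mul_one]
    rw [show 2 * Real.pi = Real.pi / (1 / 2) by ring, ← h]
    congr 1
    ext x
    congr 1
    ring
  | one =>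
    have h := integral_eq_zero_of_hasDerivAt_of_integrable hasDerivAt_exp_neg_sq_div_two
      (by simpa using (integrable_pow_mul_exp_neg_sq_div_two 1).neg)
      (by simpa using integrable_pow_mul_exp_neg_sq_div_two 0)
    rw [integral_neg, neg_eq_zero] at h
    simpa using h
  | more n ih _ =>
    have hd : ∀ x : ℝ, HasDerivAt (fun x : ℝ => x ^ (n + 1) * Real.exp (-(x ^ 2 / 2)))
        ((n + 1 : ℝ) * (x ^ n * Real.exp (-(x ^ 2 / 2))) -
          x ^ (n + 2) * Real.exp (-(x ^ 2 / 2))) x := by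
      intro x
      refine ((hasDerivAt_pow (n + 1) x).mul (hasDerivAt_exp_neg_sq_div_two x)).congr_deriv ?_
      push_cast
      ring
    have h := integral_eq_zero_of_hasDerivAt_of_integrable hd
      (((integrable_pow_mul_exp_neg_sq_div_two n).const_mul _).sub
        (integrable_pow_mul_exp_neg_sq_div_two (n + 2)))
      (integrable_pow_mul_exp_neg_sq_div_two (n + 1))
    rw [integral_sub ((integrable_pow_mul_exp_neg_sq_div_two n).const_mul _)
      (integrable_pow_mul_exp_neg_sq_div_two (n + 2)), integral_const_mul, ih, sub_eq_zero] at h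
    rw [← h]
    by_cases hn : Even n
    · rw [if_pos hn, if_pos (by simpa [Nat.even_add] using hn)]
      have : n + 2 - 1 = n + 1 := by omega
      rw [this]
      -- The case `n = 0` is separate because `n - 1` is truncated there and stands for `(-1)!! =
      -- 0!! = 1`.
      rcases n with _ | n
      · simp [Nat.doubleFactorial]
      · rw [Nat.doubleFactorial]
        simp only [add_tsub_cancel_right]
        push_cast
        ring
    · rw [if_neg hn, if_neg (by simpa [Nat.even_add] using hn), mul_zero]

variable {d : ℕ}

/-- The integrand is a product over the coordinates; a single odd exponent makes one factor vanish.
-/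
theorem integral_exp_neg_norm_sq_mul_prod_pow (α : Fin d → ℕ) :
    ∫ z : EuclideanSpace ℝ (Fin d), Real.exp (-(‖z‖ ^ 2 / 2)) * ∏ i, z i ^ α i =
      (2 * Real.pi) ^ ((d : ℝ) / 2) * (even α * doubleFactorialSubOne α) := by
  rw [← (PiLp.volume_preserving_toLp (Fin d)).integral_comp
    (MeasurableEquiv.toLp 2 _).measurableEmbedding]
  have h1 : ∀ v : Fin d → ℝ, Real.exp (-(‖WithLp.toLp 2 v‖ ^ 2 / 2)) *
      ∏ i, (WithLp.toLp 2 v : EuclideanSpace ℝ (Fin d)) i ^ α i =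
      ∏ i, v i ^ α i * Real.exp (-(v i ^ 2 / 2)) := by
    intro v
    rw [Finset.prod_mul_distrib, ← Real.exp_sum, EuclideanSpace.real_norm_sq_eq, mul_comm,
      Finset.sum_neg_distrib, Finset.sum_div]
  simp_rw [h1]
  rw [integral_fintype_prod_volume_eq_prod (fun i (x : ℝ) => x ^ α i * Real.exp (-(x ^ 2 / 2)))]
  simp_rw [integral_pow_mul_exp_neg_sq_div_two]
  rw [even]
  split_ifs with he
  · simp only [he, if_true, Finset.prod_mul_distrib, Finset.prod_const, Finset.card_univ,
      Fintype.card_fin, doubleFactorialSubOne, one_mul, Nat.cast_prod]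
    congr 1
    rw [Real.sqrt_eq_rpow, ← Real.rpow_natCast, ← Real.rpow_mul (by positivity)]
    congr 1
    ring
  · push Not at he
    obtain ⟨i, hi⟩ := he
    rw [zero_mul, mul_zero]
    exact Finset.prod_eq_zero (Finset.mem_univ i) (if_neg (by simpa using hi))

variable {E : Type*} [NormedAddCommGroup E]

theorem exists_one_add_norm_pow_mul_exp_le (M : ℕ) :
    ∃ C : ℝ, 0 ≤ C ∧ ∀ z : E, (1 + ‖z‖) ^ M * Real.exp (-(‖z‖ ^ 2 / 4)) ≤
      C * Real.exp (-(‖z‖ ^ 2 / 8)) := by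
  -- With `r = ‖z‖`, `(1 + r) ^ M ≤ M! exp (1 + r)`, and `1 + r ≤ 3 + r² / 8` because `(r - 4)² ≥
  -- 0`.
  refine ⟨M ! * Real.exp 3, by positivity, fun z => ?_⟩
  have h1 : (1 + ‖z‖) ^ M ≤ M ! * Real.exp (1 + ‖z‖) := by
    have := Real.pow_div_factorial_le_exp (1 + ‖z‖) (by positivity) M
    rwa [div_le_iff₀' (by positivity)] at this
  calc _ ≤ M ! * Real.exp (1 + ‖z‖) * Real.exp (-(‖z‖ ^ 2 / 4)) := by gcongr
    _ = M ! * Real.exp (1 + ‖z‖ + -(‖z‖ ^ 2 / 4)) := by rw [Real.exp_add _ (-_)]; ring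
    _ ≤ M ! * Real.exp (3 + -(‖z‖ ^ 2 / 8)) := by
        gcongr ?_ * Real.exp ?_
        nlinarith [sq_nonneg (‖z‖ - 4)]
    _ = _ := by rw [Real.exp_add 3]; ring

theorem integrable_exp_neg_norm_sq_div_eight [InnerProductSpace ℝ E] [FiniteDimensional ℝ E]
    [MeasurableSpace E] [BorelSpace E] :
    Integrable fun z : E => Real.exp (-(‖z‖ ^ 2 / 8)) := by
  have h := (GaussianFourier.integrable_cexp_neg_mul_sq_norm_add (V := E) (b := 1 / 8)
    (by norm_num) 0 0).norm
  refine h.congr (Eventually.of_forall fun z => ?_)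
  simp only [Complex.norm_exp]
  congr 1
  simp [← Complex.ofReal_pow]
  norm_num
  ring

end GaussianMoments

/-! ### Functions of polynomial growth -/

section PolyBounded

variable {E : Type*} [NormedAddCommGroup E]

/-- A real function on a normed group growing at most polynomially. -/
def PolyBounded (b : E → ℝ) : Prop := ∃ (C : ℝ) (M : ℕ), ∀ z, |b z| ≤ C * (1 + ‖z‖) ^ M

namespace PolyBounded

variable {b b' : E → ℝ}

theorem const (c : ℝ) : PolyBounded fun _ : E => c := ⟨|c|, 0, fun _ => by simp⟩

theorem norm_pow (n : ℕ) : PolyBounded fun z : E => ‖z‖ ^ n := by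
  refine ⟨1, n, fun z => ?_⟩
  rw [abs_of_nonneg (by positivity), one_mul]
  exact pow_le_pow_left₀ (norm_nonneg z) (by linarith) n

theorem mono (hb : PolyBounded b) (h : ∀ z, |b' z| ≤ |b z|) : PolyBounded b' := by
  obtain ⟨C, M, hC⟩ := hb
  exact ⟨C, M, fun z => (h z).trans (hC z)⟩

theorem abs (hb : PolyBounded b) : PolyBounded fun z => |b z| := hb.mono fun z => by simp

theorem mul (hb : PolyBounded b) (hb' : PolyBounded b') : PolyBounded fun z => b z * b' z := by
  obtain ⟨C, M, hC⟩ := hb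
  obtain ⟨C', M', hC'⟩ := hb'
  refine ⟨C * C', M + M', fun z => ?_⟩
  rw [abs_mul]
  calc _ ≤ (C * (1 + ‖z‖) ^ M) * (C' * (1 + ‖z‖) ^ M') :=
        mul_le_mul (hC z) (hC' z) (abs_nonneg _) ((abs_nonneg _).trans (hC z))
    _ = _ := by ring

theorem add (hb : PolyBounded b) (hb' : PolyBounded b') : PolyBounded fun z => b z + b' z := by
  obtain ⟨C, M, hC⟩ := hb
  obtain ⟨C', M', hC'⟩ := hb'
  refine ⟨|C| + |C'|, M + M', fun z => (abs_add_le _ _).trans ?_⟩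
  have h1 : (1 : ℝ) ≤ 1 + ‖z‖ := by linarith [norm_nonneg z]
  have e1 : C * (1 + ‖z‖) ^ M ≤ |C| * (1 + ‖z‖) ^ (M + M') :=
    mul_le_mul (le_abs_self C) (pow_le_pow_right₀ h1 (by omega)) (by positivity) (abs_nonneg C)
  have e2 : C' * (1 + ‖z‖) ^ M' ≤ |C'| * (1 + ‖z‖) ^ (M + M') :=
    mul_le_mul (le_abs_self C') (pow_le_pow_right₀ h1 (by omega)) (by positivity) (abs_nonneg C')
  linarith [hC z, hC' z]

theorem sum {ι : Type*} {s : Finset ι} {b : ι → E → ℝ} (hb : ∀ i ∈ s, PolyBounded (b i)) :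
    PolyBounded fun z => ∑ i ∈ s, b i z := by
  classical
  induction s using Finset.induction_on with
  | empty => simpa using const 0
  | insert i s hi ih =>
    simp only [Finset.sum_insert hi]
    exact (hb i (by simp)).add (ih fun j hj => hb j (by simp [hj]))

theorem exists_mul_exp_le (hb : PolyBounded b) : ∃ C : ℝ, ∀ z,
    |b z| * Real.exp (-(‖z‖ ^ 2 / 4)) ≤ C * Real.exp (-(‖z‖ ^ 2 / 8)) := by
  obtain ⟨C, M, hC⟩ := hb
  obtain ⟨K, hK0, hK⟩ := exists_one_add_norm_pow_mul_exp_le (E := E) M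
  refine ⟨|C| * K, fun z => ?_⟩
  calc _ ≤ (|C| * (1 + ‖z‖) ^ M) * Real.exp (-(‖z‖ ^ 2 / 4)) := by
        gcongr
        exact (hC z).trans (by gcongr; exact le_abs_self C)
    _ = |C| * ((1 + ‖z‖) ^ M * Real.exp (-(‖z‖ ^ 2 / 4))) := by ring
    _ ≤ |C| * (K * Real.exp (-(‖z‖ ^ 2 / 8))) := mul_le_mul_of_nonneg_left (hK z) (abs_nonneg C)
    _ = _ := by ring

theorem integrable_mul_exp [InnerProductSpace ℝ E] [FiniteDimensional ℝ E]
    [MeasurableSpace E] [BorelSpace E] (hb : PolyBounded b) (hc : Continuous b) :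
    MeasureTheory.Integrable fun z => Real.exp (-(‖z‖ ^ 2 / 2)) * b z := by
  obtain ⟨C, hC⟩ := hb.exists_mul_exp_le
  refine (integrable_exp_neg_norm_sq_div_eight.const_mul C).mono'
    (by fun_prop) (Eventually.of_forall fun z => ?_)
  rw [norm_mul, Real.norm_of_nonneg (Real.exp_nonneg _), Real.norm_eq_abs, mul_comm]
  refine le_trans ?_ (hC z)
  gcongr
  norm_num

end PolyBounded

end PolyBounded

/-! ### Calculus of expansions in the scaling parameter -/

section ScaledExpansion

variable {E : Type*} [NormedAddCommGroup E]

/-- The sum of the terms of degree at most `N` of a formal power series at `t`. -/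
noncomputable def PowerSeries.partialSum (N : ℕ) (c : PowerSeries ℝ) (t : ℝ) : ℝ :=
  ∑ s ∈ Finset.range (N + 1), PowerSeries.coeff s c * t ^ s

/-- The family of functions `h t` has an expansion in powers of `t` up to order `t ^ N` as
`t → 0⁺` with coefficients of polynomial growth, pointwise with error `o(t ^ N)`, and with error
bounded by `t ^ N` times a function of polynomial growth in the region `t * ‖z‖ < δ`. -/
structure HasScaledExpansion (δ : ℝ) (N : ℕ) (h : ℝ → E → ℝ) (c : E → PowerSeries ℝ) : Prop where
  continuous_coeff : ∀ s, Continuous fun z => PowerSeries.coeff s (c z)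
  polyBounded_coeff : ∀ s, PolyBounded fun z => PowerSeries.coeff s (c z)
  bound : ∃ b : E → ℝ, PolyBounded b ∧ ∀ t z, 0 < t → t ≤ 1 → t * ‖z‖ < δ →
    |h t z - (c z).partialSum N t| ≤ t ^ N * b z
  isLittleO : ∀ z, (fun t => h t z - (c z).partialSum N t) =o[𝓝[>] 0] fun t : ℝ => t ^ N

namespace PowerSeries

theorem partialSum_add (N : ℕ) (p q : PowerSeries ℝ) (t : ℝ) :
    (p + q).partialSum N t = p.partialSum N t + q.partialSum N t := by
  simp [partialSum, add_mul, Finset.sum_add_distrib]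

theorem partialSum_C_mul (N : ℕ) (a : ℝ) (p : PowerSeries ℝ) (t : ℝ) :
    (PowerSeries.C a * p).partialSum N t = a * p.partialSum N t := by
  simp [partialSum, mul_assoc, Finset.mul_sum]

theorem partialSum_one (N : ℕ) (t : ℝ) : (1 : PowerSeries ℝ).partialSum N t = 1 := by
  simp [partialSum, PowerSeries.coeff_one]

theorem tendsto_partialSum (N : ℕ) (p : PowerSeries ℝ) :
    Tendsto (p.partialSum N) (𝓝[>] 0) (𝓝 (PowerSeries.coeff 0 p)) := by
  have h : Continuous (p.partialSum N) := by unfold partialSum; fun_prop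
  have h0 : p.partialSum N 0 = PowerSeries.coeff 0 p := by
    rw [partialSum, Finset.sum_range_succ', Finset.sum_eq_zero (by simp)]
    simp
  rw [← h0]
  exact h.continuousAt.tendsto.mono_left nhdsWithin_le_nhds

/-- The sum of the absolute values of the coefficients of degree at most `N`. -/
noncomputable def absSum (N : ℕ) (p : PowerSeries ℝ) : ℝ :=
  ∑ s ∈ Finset.range (N + 1), |PowerSeries.coeff s p|

theorem absSum_nonneg (N : ℕ) (p : PowerSeries ℝ) : 0 ≤ p.absSum N :=
  Finset.sum_nonneg fun _ _ => abs_nonneg _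

theorem abs_partialSum_le (N : ℕ) (p : PowerSeries ℝ) {t : ℝ} (h0 : 0 < t) (h1 : t ≤ 1) :
    |p.partialSum N t| ≤ p.absSum N := by
  refine (Finset.abs_sum_le_sum_abs _ _).trans (Finset.sum_le_sum fun s _ => ?_)
  rw [abs_mul, abs_of_pos (pow_pos h0 s)]
  exact mul_le_of_le_one_right (abs_nonneg _) (pow_le_one₀ h0.le h1)

/-- The cross terms of total degree at most `N` are exactly the truncated product; those of higher
degree remain. -/
theorem partialSum_mul_sub (N : ℕ) (p q : PowerSeries ℝ) (t : ℝ) :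
    p.partialSum N t * q.partialSum N t - (p * q).partialSum N t =
      ∑ x ∈ (Finset.range (N + 1) ×ˢ Finset.range (N + 1)).filter fun x => ¬ x.1 + x.2 ≤ N,
        PowerSeries.coeff x.1 p * PowerSeries.coeff x.2 q * t ^ (x.1 + x.2) := by
  have h1 : p.partialSum N t * q.partialSum N t =
      ∑ x ∈ Finset.range (N + 1) ×ˢ Finset.range (N + 1),
        PowerSeries.coeff x.1 p * PowerSeries.coeff x.2 q * t ^ (x.1 + x.2) := by
    rw [partialSum, partialSum, Finset.sum_mul_sum, ← Finset.sum_product']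
    exact Finset.sum_congr rfl fun x _ => by ring
  have h2 : (p * q).partialSum N t =
      ∑ x ∈ (Finset.range (N + 1) ×ˢ Finset.range (N + 1)).filter fun x => x.1 + x.2 ≤ N,
        PowerSeries.coeff x.1 p * PowerSeries.coeff x.2 q * t ^ (x.1 + x.2) := by
    rw [partialSum, ← Finset.sum_fiberwise_of_maps_to (t := Finset.range (N + 1))
      (g := fun x : ℕ × ℕ => x.1 + x.2)
      (fun x hx => by
        have := (Finset.mem_filter.1 hx).2
        simp only [Finset.mem_range]
        omega)]
    refine Finset.sum_congr rfl fun s hs => ?_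
    rw [PowerSeries.coeff_mul, Finset.sum_mul]
    have hset : (((Finset.range (N + 1) ×ˢ Finset.range (N + 1)).filter
        fun x => x.1 + x.2 ≤ N).filter fun x => x.1 + x.2 = s) = Finset.HasAntidiagonal.antidiagonal s := by
      ext x
      simp only [Finset.mem_filter, Finset.mem_product, Finset.mem_range,
        Finset.HasAntidiagonal.mem_antidiagonal] at hs ⊢
      omega
    rw [hset]
    exact Finset.sum_congr rfl fun x hx => by rw [Finset.HasAntidiagonal.mem_antidiagonal.1 hx]
  rw [h1, h2, ← Finset.sum_filter_add_sum_filter_not _ fun x : ℕ × ℕ => x.1 + x.2 ≤ N]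
  ring

theorem abs_partialSum_mul_sub_le (N : ℕ) (p q : PowerSeries ℝ) {t : ℝ} (h0 : 0 < t)
    (h1 : t ≤ 1) :
    |p.partialSum N t * q.partialSum N t - (p * q).partialSum N t| ≤
      t ^ (N + 1) * (p.absSum N * q.absSum N) := by
  rw [partialSum_mul_sub, absSum, absSum, Finset.sum_mul_sum, ← Finset.sum_product',
    Finset.mul_sum]
  refine (Finset.abs_sum_le_sum_abs _ _).trans ((Finset.sum_le_sum fun x hx => ?_).trans
    (Finset.sum_le_sum_of_subset_of_nonneg (Finset.filter_subset _ _) fun x _ _ => by positivity))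
  rw [abs_mul, abs_mul, abs_of_pos (pow_pos h0 _), mul_comm]
  have := (Finset.mem_filter.1 hx).2
  exact mul_le_mul_of_nonneg_right (pow_le_pow_of_le_one h0.le h1 (by omega)) (by positivity)

end PowerSeries

theorem isLittleO_of_abs_le_pow_succ {N : ℕ} {f : ℝ → ℝ} {C : ℝ}
    (h : ∀ t, 0 < t → t ≤ 1 → |f t| ≤ t ^ (N + 1) * C) : f =o[𝓝[>] 0] fun t : ℝ => t ^ N := by
  have h1 : f =O[𝓝[>] 0] fun t : ℝ => t ^ (N + 1) := by
    refine IsBigO.of_bound C ?_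
    filter_upwards [Ioc_mem_nhdsGT (zero_lt_one (α := ℝ))] with t ht
    rw [Real.norm_eq_abs, norm_pow, Real.norm_of_nonneg ht.1.le, mul_comm]
    exact h t ht.1 ht.2
  exact h1.trans_isLittleO ((isLittleO_pow_pow (by omega)).mono nhdsWithin_le_nhds)

namespace HasScaledExpansion

variable {δ : ℝ} {N : ℕ} {h h' : ℝ → E → ℝ} {c c' : E → PowerSeries ℝ}

theorem polyBounded_absSum (H : HasScaledExpansion δ N h c) :
    PolyBounded fun z => (c z).absSum N :=
  PolyBounded.sum fun s _ => (H.polyBounded_coeff s).abs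

theorem exists_abs_le (H : HasScaledExpansion δ N h c) : ∃ b : E → ℝ, PolyBounded b ∧
    ∀ t z, 0 < t → t ≤ 1 → t * ‖z‖ < δ → |h t z| ≤ b z := by
  obtain ⟨b, hb, hbd⟩ := H.bound
  refine ⟨fun z => |b z| + (c z).absSum N, hb.abs.add H.polyBounded_absSum,
    fun t z h0 h1 hz => ?_⟩
  have e1 : t ^ N * b z ≤ |b z| :=
    (mul_le_mul_of_nonneg_left (le_abs_self _) (by positivity)).trans
      (mul_le_of_le_one_left (abs_nonneg _) (pow_le_one₀ h0.le h1))
  have e2 := (c z).abs_partialSum_le N h0 h1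
  have e3 := abs_add_le (h t z - (c z).partialSum N t) ((c z).partialSum N t)
  rw [sub_add_cancel] at e3
  linarith [hbd t z h0 h1 hz]

theorem isBigO_one (H : HasScaledExpansion δ N h c) (z : E) :
    (fun t => h t z) =O[𝓝[>] 0] fun _ => (1 : ℝ) := by
  have h1 : (fun t => h t z - (c z).partialSum N t) =O[𝓝[>] 0] fun _ => (1 : ℝ) := by
    refine (H.isLittleO z).isBigO.trans (IsBigO.of_bound 1 ?_)
    filter_upwards [Ioc_mem_nhdsGT (zero_lt_one (α := ℝ))] with t ht
    rw [norm_pow, Real.norm_of_nonneg ht.1.le]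
    simpa using pow_le_one₀ ht.1.le ht.2
  simpa using h1.add (((c z).tendsto_partialSum N).isBigO_one ℝ)

theorem mul (H : HasScaledExpansion δ N h c) (H' : HasScaledExpansion δ N h' c') :
    HasScaledExpansion δ N (fun t z => h t z * h' t z) (fun z => c z * c' z) := by
  -- Three errors: that of `h` times the bounded `h'`, that of `h'` times the bounded truncation of
  -- `c`, and the defect of truncating a product, which is of order `t ^ (N + 1)`.
  have split : ∀ t z, h t z * h' t z - (c z * c' z).partialSum N t =
      (h t z - (c z).partialSum N t) * h' t z +
      (c z).partialSum N t * (h' t z - (c' z).partialSum N t) +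
      ((c z).partialSum N t * (c' z).partialSum N t - (c z * c' z).partialSum N t) :=
    fun t z => by ring
  refine ⟨fun s => ?_, fun s => ?_, ?_, fun z => ?_⟩
  · simp only [PowerSeries.coeff_mul]
    exact continuous_finsetSum _ fun x _ =>
      (H.continuous_coeff x.1).mul (H'.continuous_coeff x.2)
  · simp only [PowerSeries.coeff_mul]
    exact PolyBounded.sum fun x _ => (H.polyBounded_coeff x.1).mul (H'.polyBounded_coeff x.2)
  · obtain ⟨b, hb, hbd⟩ := H.bound
    obtain ⟨b', hb', hbd'⟩ := H'.bound
    obtain ⟨B', hB', hBd'⟩ := H'.exists_abs_le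
    refine ⟨fun z => b z * B' z + (c z).absSum N * b' z + (c z).absSum N * (c' z).absSum N,
      ((hb.mul hB').add (H.polyBounded_absSum.mul hb')).add
        (H.polyBounded_absSum.mul H'.polyBounded_absSum), fun t z h0 h1 hz => ?_⟩
    rw [split]
    refine (abs_add_le _ _).trans ?_
    have e0 := abs_add_le ((h t z - (c z).partialSum N t) * h' t z)
      ((c z).partialSum N t * (h' t z - (c' z).partialSum N t))
    rw [abs_mul, abs_mul] at e0
    have e1 := mul_le_mul (hbd t z h0 h1 hz) (hBd' t z h0 h1 hz) (abs_nonneg _)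
      ((abs_nonneg _).trans (hbd t z h0 h1 hz))
    have e2 := mul_le_mul ((c z).abs_partialSum_le N h0 h1) (hbd' t z h0 h1 hz) (abs_nonneg _)
      ((c z).absSum_nonneg N)
    have e3 := PowerSeries.abs_partialSum_mul_sub_le N (c z) (c' z) h0 h1
    have e4 : t ^ (N + 1) * ((c z).absSum N * (c' z).absSum N) ≤
        t ^ N * ((c z).absSum N * (c' z).absSum N) :=
      mul_le_mul_of_nonneg_right (pow_le_pow_of_le_one h0.le h1 (by omega))
        (mul_nonneg ((c z).absSum_nonneg N) ((c' z).absSum_nonneg N))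
    calc _ ≤ t ^ N * b z * B' z + (c z).absSum N * (t ^ N * b' z) +
          t ^ N * ((c z).absSum N * (c' z).absSum N) := by linarith
      _ = _ := by ring
  · simp only [split]
    refine IsLittleO.add (IsLittleO.add ?_ ?_) ?_
    · simpa using (H.isLittleO z).mul_isBigO (H'.isBigO_one z)
    · simpa using ((c z).tendsto_partialSum N).isBigO_one ℝ |>.mul_isLittleO (H'.isLittleO z)
    · exact isLittleO_of_abs_le_pow_succ fun t h0 h1 =>
        PowerSeries.abs_partialSum_mul_sub_le N (c z) (c' z) h0 h1

theorem add (H : HasScaledExpansion δ N h c) (H' : HasScaledExpansion δ N h' c') :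
    HasScaledExpansion δ N (fun t z => h t z + h' t z) (fun z => c z + c' z) := by
  have split : ∀ t z, h t z + h' t z - (c z + c' z).partialSum N t =
      (h t z - (c z).partialSum N t) + (h' t z - (c' z).partialSum N t) := fun t z => by
    rw [PowerSeries.partialSum_add]
    ring
  refine ⟨fun s => ?_, fun s => ?_, ?_, fun z => ?_⟩
  · simp only [map_add]
    exact (H.continuous_coeff s).add (H'.continuous_coeff s)
  · simpa only [map_add] using (H.polyBounded_coeff s).add (H'.polyBounded_coeff s)
  · obtain ⟨b, hb, hbd⟩ := H.bound
    obtain ⟨b', hb', hbd'⟩ := H'.bound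
    refine ⟨fun z => b z + b' z, hb.add hb', fun t z h0 h1 hz => ?_⟩
    rw [split, mul_add]
    exact (abs_add_le _ _).trans (add_le_add (hbd t z h0 h1 hz) (hbd' t z h0 h1 hz))
  · simp only [split]
    exact (H.isLittleO z).add (H'.isLittleO z)

theorem const_mul (a : ℝ) (H : HasScaledExpansion δ N h c) :
    HasScaledExpansion δ N (fun t z => a * h t z) (fun z => PowerSeries.C a * c z) := by
  have split : ∀ t z, a * h t z - (PowerSeries.C a * c z).partialSum N t =
      a * (h t z - (c z).partialSum N t) := fun t z => by
    rw [PowerSeries.partialSum_C_mul]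
    ring
  refine ⟨fun s => ?_, fun s => ?_, ?_, fun z => ?_⟩
  · simpa only [PowerSeries.coeff_C_mul] using (H.continuous_coeff s).const_mul a
  · simpa only [PowerSeries.coeff_C_mul] using (PolyBounded.const a).mul (H.polyBounded_coeff s)
  · obtain ⟨b, hb, hbd⟩ := H.bound
    refine ⟨fun z => |a| * b z, (PolyBounded.const |a|).mul hb, fun t z h0 h1 hz => ?_⟩
    rw [split, abs_mul]
    calc _ ≤ |a| * (t ^ N * b z) := by gcongr; exact hbd t z h0 h1 hz
      _ = _ := by ring
  · simp only [split]
    exact (H.isLittleO z).const_mul_left a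

theorem one : HasScaledExpansion (E := E) δ N (fun _ _ => 1) (fun _ => 1) := by
  refine ⟨fun s => continuous_const, fun s => PolyBounded.const _, ⟨0, PolyBounded.const 0, ?_⟩,
    fun z => ?_⟩
  · simp [PowerSeries.partialSum_one]
  · simp [PowerSeries.partialSum_one]

theorem pow (H : HasScaledExpansion δ N h c) (r : ℕ) :
    HasScaledExpansion δ N (fun t z => h t z ^ r) (fun z => c z ^ r) := by
  induction r with
  | zero => simpa using one
  | succ r ih => simpa only [pow_succ] using ih.mul H

theorem sum_range {h : ℕ → ℝ → E → ℝ} {c : ℕ → E → PowerSeries ℝ}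
    (H : ∀ r, HasScaledExpansion δ N (h r) (c r)) (n : ℕ) :
    HasScaledExpansion δ N (fun t z => ∑ r ∈ Finset.range (n + 1), h r t z)
      (fun z => ∑ r ∈ Finset.range (n + 1), c r z) := by
  induction n with
  | zero => simpa using H 0
  | succ n ih => simpa only [Finset.sum_range_succ _ (n + 1)] using ih.add (H (n + 1))

/-- Without constant term, `c ^ (N + 1)` is divisible by `X ^ (N + 1)`, so its truncation vanishes
and the whole power counts as remainder. This controls the tail of the exponential series. -/
theorem pow_succ_bound (H : HasScaledExpansion δ N h c) (hc : ∀ z, PowerSeries.coeff 0 (c z) = 0) :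
    (∃ b : E → ℝ, PolyBounded b ∧ ∀ t z, 0 < t → t ≤ 1 → t * ‖z‖ < δ →
      |h t z ^ (N + 1)| ≤ t ^ N * b z) ∧
    ∀ z, (fun t => h t z ^ (N + 1)) =o[𝓝[>] 0] fun t : ℝ => t ^ N := by
  have hz : ∀ z t, (c z ^ (N + 1)).partialSum N t = 0 := by
    intro z t
    refine Finset.sum_eq_zero fun s hs => ?_
    have hdvd : (PowerSeries.X : PowerSeries ℝ) ^ (N + 1) ∣ c z ^ (N + 1) :=
      pow_dvd_pow_of_dvd (PowerSeries.X_dvd_iff.2 (by simpa using hc z)) _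
    rw [PowerSeries.X_pow_dvd_iff.1 hdvd s (Finset.mem_range.1 hs), zero_mul]
  have Hp := H.pow (N + 1)
  obtain ⟨b, hb, hbd⟩ := Hp.bound
  refine ⟨⟨b, hb, fun t z h0 h1 hzd => ?_⟩, fun z => ?_⟩
  · simpa [hz] using hbd t z h0 h1 hzd
  · simpa [hz] using Hp.isLittleO z

end HasScaledExpansion

end ScaledExpansion

theorem Real.abs_exp_sub_sum_le (x : ℝ) (n : ℕ) :
    |Real.exp x - ∑ m ∈ Finset.range n, x ^ m / m !| ≤ |x| ^ n * Real.exp |x| := by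
  have := Complex.norm_exp_sub_sum_le_norm_mul_exp (x : ℂ) n
  rw [Complex.norm_real, Real.norm_eq_abs] at this
  rw [← Real.norm_eq_abs, ← Complex.norm_real]
  push_cast
  exact this

/-! ### Laplace's method in rescaled coordinates -/

section LaplaceCore

open MeasureTheory

variable {E : Type*} [NormedAddCommGroup E]

/-- The exponential series of `-a`, truncated after `a ^ N`, times `γ`. -/
noncomputable def PowerSeries.expNegMul (N : ℕ) (a γ : PowerSeries ℝ) : PowerSeries ℝ :=
  (∑ r ∈ Finset.range (N + 1), PowerSeries.C ((-1) ^ r / (r ! : ℝ)) * a ^ r) * γ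

variable {F G : E → ℝ} {δ : ℝ} {N : ℕ} {a γ : E → PowerSeries ℝ}

theorem HasScaledExpansion.expNegMul {u v : ℝ → E → ℝ} (hu : HasScaledExpansion δ N u a)
    (hv : HasScaledExpansion δ N v γ) :
    HasScaledExpansion δ N
      (fun t z => (∑ r ∈ Finset.range (N + 1), (-u t z) ^ r / r !) * v t z)
      (fun z => (a z).expNegMul N (γ z)) := by
  have h := (HasScaledExpansion.sum_range
    (fun r => (hu.pow r).const_mul ((-1) ^ r / (r ! : ℝ))) N).mul hv
  have he : ∀ t z, (∑ r ∈ Finset.range (N + 1), (-1) ^ r / (r ! : ℝ) * u t z ^ r) =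
      ∑ r ∈ Finset.range (N + 1), (-u t z) ^ r / r ! := fun t z =>
    Finset.sum_congr rfl fun r _ => by rw [neg_pow (u t z)]; ring
  simpa only [he, PowerSeries.expNegMul] using h

variable [InnerProductSpace ℝ E]

theorem exp_neg_div_sq_eq (F : E → ℝ) (t : ℝ) (z : E) :
    Real.exp (-(F (t • z) / t ^ 2)) =
      Real.exp (-(‖z‖ ^ 2 / 2)) * Real.exp (-(F (t • z) / t ^ 2 - ‖z‖ ^ 2 / 2)) := by
  rw [← Real.exp_add]
  congr 1
  ring

theorem abs_div_sq_sub_le (hquad : ∀ y ∈ Metric.ball (0 : E) δ, |F y - ‖y‖ ^ 2 / 2| ≤ ‖y‖ ^ 2 / 4)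
    {t : ℝ} (ht : 0 < t) {z : E} (hz : t * ‖z‖ < δ) :
    |F (t • z) / t ^ 2 - ‖z‖ ^ 2 / 2| ≤ ‖z‖ ^ 2 / 4 := by
  have hn : ‖t • z‖ = t * ‖z‖ := by rw [norm_smul, Real.norm_of_nonneg ht.le]
  have h := hquad (t • z) (by rwa [mem_ball_zero_iff, hn])
  rw [hn] at h
  have he : F (t • z) / t ^ 2 - ‖z‖ ^ 2 / 2 = (F (t • z) - (t * ‖z‖) ^ 2 / 2) / t ^ 2 := by
    field_simp
  rw [he, abs_div, abs_of_pos (pow_pos ht 2), div_le_iff₀ (by positivity)]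
  calc _ ≤ _ := h
    _ = _ := by ring

variable [FiniteDimensional ℝ E] [MeasurableSpace E] [BorelSpace E]

theorem measurable_indicator_scaled (hF : ContinuousOn F (Metric.ball 0 δ))
    (hG : ContinuousOn G (Metric.ball 0 δ)) {t : ℝ} (ht : 0 < t) :
    AEStronglyMeasurable ({z : E | t * ‖z‖ < δ}.indicator
      fun z => Real.exp (-(F (t • z) / t ^ 2)) * G (t • z)) volume := by
  have hmaps : Set.MapsTo (fun z : E => t • z) {z : E | t * ‖z‖ < δ} (Metric.ball 0 δ) := by
    intro z hz
    rw [mem_ball_zero_iff, norm_smul, Real.norm_of_nonneg ht.le]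
    exact hz
  have hopen : IsOpen {z : E | t * ‖z‖ < δ} := isOpen_lt (by fun_prop) continuous_const
  rw [aestronglyMeasurable_indicator_iff hopen.measurableSet]
  refine ContinuousOn.aestronglyMeasurable ?_ hopen.measurableSet
  have h1 : ContinuousOn (fun z : E => F (t • z)) {z : E | t * ‖z‖ < δ} :=
    hF.comp (by fun_prop) hmaps
  have h2 : ContinuousOn (fun z : E => G (t • z)) {z : E | t * ‖z‖ < δ} :=
    hG.comp (by fun_prop) hmaps
  exact (Real.continuous_exp.comp_continuousOn (h1.div_const _).neg).mul h2

/-- Laplace's method in rescaled coordinates, for an integrand on a ball. -/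
theorem isLittleO_integral_scaled (hδ : 0 < δ)
    (hF : ContinuousOn F (Metric.ball 0 δ)) (hG : ContinuousOn G (Metric.ball 0 δ))
    (hquad : ∀ y ∈ Metric.ball (0 : E) δ, |F y - ‖y‖ ^ 2 / 2| ≤ ‖y‖ ^ 2 / 4)
    (ha : HasScaledExpansion δ N (fun t z => F (t • z) / t ^ 2 - ‖z‖ ^ 2 / 2) a)
    (ha0 : ∀ z, PowerSeries.coeff 0 (a z) = 0)
    (hγ : HasScaledExpansion δ N (fun t z => G (t • z)) γ) :
    (fun t : ℝ => (∫ z : E, {z : E | t * ‖z‖ < δ}.indicator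
        (fun z => Real.exp (-(F (t • z) / t ^ 2)) * G (t • z)) z) -
      ∑ s ∈ Finset.range (N + 1), (∫ z : E, Real.exp (-(‖z‖ ^ 2 / 2)) *
        PowerSeries.coeff s ((a z).expNegMul N (γ z))) * t ^ s) =o[𝓝[>] 0] fun t => t ^ N := by
  set u : ℝ → E → ℝ := fun t z => F (t • z) / t ^ 2 - ‖z‖ ^ 2 / 2 with hu
  set q : E → PowerSeries ℝ := fun z => (a z).expNegMul N (γ z) with hq
  set I : ℝ → E → ℝ := fun t => {z : E | t * ‖z‖ < δ}.indicator
    fun z => Real.exp (-(F (t • z) / t ^ 2)) * G (t • z) with hI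
  have hexp : HasScaledExpansion δ N
      (fun t z => (∑ r ∈ Finset.range (N + 1), (-u t z) ^ r / r !) * G (t • z)) q :=
    ha.expNegMul hγ
  have hqi : ∀ s, Integrable fun z : E =>
      Real.exp (-(‖z‖ ^ 2 / 2)) * PowerSeries.coeff s (q z) := fun s =>
    (hexp.polyBounded_coeff s).integrable_mul_exp (hexp.continuous_coeff s)
  obtain ⟨⟨b₁, hb₁, hbd₁⟩, hlim₁⟩ := ha.pow_succ_bound ha0
  obtain ⟨b₂, hb₂, hbd₂⟩ := hexp.bound
  obtain ⟨b₃, hb₃, hbd₃⟩ := hγ.exists_abs_le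
  -- the integrand in the region, relative to the Gaussian
  have hregion : ∀ t z, 0 < t → t * ‖z‖ < δ →
      |I t z - Real.exp (-(‖z‖ ^ 2 / 2)) * (q z).partialSum N t| ≤
      Real.exp (-(‖z‖ ^ 2 / 4)) * (|u t z ^ (N + 1)| * |G (t • z)| +
        |(∑ r ∈ Finset.range (N + 1), (-u t z) ^ r / r !) * G (t • z) -
          (q z).partialSum N t|) := by
    intro t z ht hz
    have hI' : I t z = Real.exp (-(‖z‖ ^ 2 / 2)) * Real.exp (-u t z) * G (t • z) := by
      rw [hI, hu, ← exp_neg_div_sq_eq]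
      exact Set.indicator_of_mem (s := {z : E | t * ‖z‖ < δ}) hz _
    -- The first summand is the tail of the exponential series, the second the error of the
    -- expansion of the truncated series times `G`.
    have hsplit : I t z - Real.exp (-(‖z‖ ^ 2 / 2)) * (q z).partialSum N t =
        Real.exp (-(‖z‖ ^ 2 / 2)) *
          ((Real.exp (-u t z) - ∑ r ∈ Finset.range (N + 1), (-u t z) ^ r / r !) * G (t • z)) +
        Real.exp (-(‖z‖ ^ 2 / 2)) *
          ((∑ r ∈ Finset.range (N + 1), (-u t z) ^ r / r !) * G (t • z) -
            (q z).partialSum N t) := by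
      rw [hI']
      ring
    have hule : |u t z| ≤ ‖z‖ ^ 2 / 4 := abs_div_sq_sub_le hquad ht hz
    have e1 := Real.abs_exp_sub_sum_le (-u t z) (N + 1)
    rw [abs_neg, ← abs_pow] at e1
    -- Half of the Gaussian exponent pays for `exp |u|`, since `|u| ≤ ‖z‖² / 4`; the other half
    -- remains for integrability.
    have e2 : Real.exp (-(‖z‖ ^ 2 / 2)) * Real.exp |u t z| ≤ Real.exp (-(‖z‖ ^ 2 / 4)) := by
      rw [← Real.exp_add]
      exact Real.exp_le_exp.2 (by linarith)
    have e3 : Real.exp (-(‖z‖ ^ 2 / 2)) ≤ Real.exp (-(‖z‖ ^ 2 / 4)) :=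
      Real.exp_le_exp.2 (by nlinarith [sq_nonneg ‖z‖])
    rw [hsplit, mul_add]
    refine (abs_add_le _ _).trans (add_le_add ?_ ?_)
    · rw [abs_mul, abs_mul, abs_of_pos (Real.exp_pos _)]
      calc _ ≤ Real.exp (-(‖z‖ ^ 2 / 2)) *
            (|u t z ^ (N + 1)| * Real.exp |u t z| * |G (t • z)|) := by gcongr
        _ = (Real.exp (-(‖z‖ ^ 2 / 2)) * Real.exp |u t z|) *
            (|u t z ^ (N + 1)| * |G (t • z)|) := by ring
        _ ≤ _ := by gcongr
    · rw [abs_mul, abs_of_pos (Real.exp_pos _)]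
      gcongr
  -- the majorant
  set B : E → ℝ := fun z => |b₁ z| * |b₃ z| + |b₂ z| + ‖z‖ ^ N * ((δ ^ N)⁻¹ * (q z).absSum N)
    with hB
  have hBpoly : PolyBounded B :=
    ((hb₁.abs.mul hb₃.abs).add hb₂.abs).add
      ((PolyBounded.norm_pow N).mul ((PolyBounded.const _).mul hexp.polyBounded_absSum))
  have hdom : ∀ t z, 0 < t → t ≤ 1 →
      |I t z - Real.exp (-(‖z‖ ^ 2 / 2)) * (q z).partialSum N t| ≤
        t ^ N * (|B z| * Real.exp (-(‖z‖ ^ 2 / 4))) := by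
    intro t z h0 h1
    have hq0 := (q z).absSum_nonneg N
    have htN : 0 < t ^ N := pow_pos h0 N
    have hB0 : 0 ≤ B z := by positivity
    rw [abs_of_nonneg hB0]
    by_cases hz : t * ‖z‖ < δ
    · refine (hregion t z h0 hz).trans ?_
      have e1 : |u t z ^ (N + 1)| * |G (t • z)| ≤ t ^ N * |b₁ z| * |b₃ z| :=
        mul_le_mul ((hbd₁ t z h0 h1 hz).trans
          (mul_le_mul_of_nonneg_left (le_abs_self _) htN.le))
          ((hbd₃ t z h0 h1 hz).trans (le_abs_self _)) (abs_nonneg _) (by positivity)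
      have e2 := (hbd₂ t z h0 h1 hz).trans (mul_le_mul_of_nonneg_left (le_abs_self _) htN.le)
      have e3 : 0 ≤ t ^ N * (‖z‖ ^ N * ((δ ^ N)⁻¹ * (q z).absSum N)) := by positivity
      calc _ ≤ Real.exp (-(‖z‖ ^ 2 / 4)) * (t ^ N * B z) := by
            gcongr
            simp only [hB]
            linarith
        _ = _ := by ring
    -- Outside the region only the expansion is left. There `1 ≤ (t ‖z‖ / δ) ^ N`, which produces
    -- the factor `t ^ N` at the cost of a polynomial in `‖z‖`.
    · have hI0 : I t z = 0 := Set.indicator_of_notMem (s := {z : E | t * ‖z‖ < δ}) hz _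
      rw [hI0, zero_sub, abs_neg, abs_mul, abs_of_pos (Real.exp_pos _)]
      have e1 := (q z).abs_partialSum_le N h0 h1
      have e2 : δ ^ N ≤ t ^ N * ‖z‖ ^ N := by
        rw [← mul_pow]
        exact pow_le_pow_left₀ hδ.le (not_lt.1 hz) N
      have e3 : 1 ≤ t ^ N * ‖z‖ ^ N * (δ ^ N)⁻¹ := by
        rw [← div_eq_mul_inv, le_div_iff₀ (pow_pos hδ N), one_mul]
        exact e2
      have e4 : (q z).absSum N ≤ t ^ N * ‖z‖ ^ N * (δ ^ N)⁻¹ * (q z).absSum N :=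
        le_mul_of_one_le_left hq0 e3
      have e5 : 0 ≤ t ^ N * (|b₁ z| * |b₃ z| + |b₂ z|) := by positivity
      calc _ ≤ Real.exp (-(‖z‖ ^ 2 / 4)) * (t ^ N * B z) := by
            refine mul_le_mul (Real.exp_le_exp.2 (by nlinarith [sq_nonneg ‖z‖])) ?_
              (abs_nonneg _) (Real.exp_nonneg _)
            simp only [hB]
            linarith
        _ = _ := by ring
  have hpoint : ∀ z, (fun t => I t z - Real.exp (-(‖z‖ ^ 2 / 2)) * (q z).partialSum N t)
      =o[𝓝[>] 0] fun t : ℝ => t ^ N := by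
    intro z
    have hev : ∀ᶠ t in 𝓝[>] (0 : ℝ), 0 < t ∧ t * ‖z‖ < δ := by
      have h1 : ∀ᶠ t in 𝓝 (0 : ℝ), t * ‖z‖ < δ :=
        (continuous_id.mul continuous_const).continuousAt.eventually_lt continuousAt_const
          (by simpa using hδ)
      exact (eventually_mem_nhdsWithin).and (h1.filter_mono nhdsWithin_le_nhds)
    have h1 : (fun t => |u t z ^ (N + 1)| * |G (t • z)|) =o[𝓝[>] 0] fun t : ℝ => t ^ N := by
      simpa using (hlim₁ z).norm_left.mul_isBigO (hγ.isBigO_one z).norm_left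
    have h2 := (h1.add (hexp.isLittleO z).norm_left).const_mul_left (Real.exp (-(‖z‖ ^ 2 / 4)))
    refine (IsBigO.of_bound 1 ?_).trans_isLittleO h2
    filter_upwards [hev] with t ht
    rw [one_mul]
    exact (hregion t z ht.1 ht.2).trans (le_abs_self _)
  -- integrability
  obtain ⟨C, hC⟩ := hBpoly.exists_mul_exp_le
  have hmeasI : ∀ t, 0 < t → AEStronglyMeasurable (I t) volume := fun t ht =>
    measurable_indicator_scaled hF hG ht
  have hpsi : ∀ t, Integrable fun z : E =>
      Real.exp (-(‖z‖ ^ 2 / 2)) * (q z).partialSum N t := by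
    intro t
    have := integrable_finsetSum (Finset.range (N + 1)) fun s _ => (hqi s).mul_const (t ^ s)
    refine this.congr (Eventually.of_forall fun z => ?_)
    simp only [PowerSeries.partialSum, Finset.mul_sum, mul_assoc]
  have hpsiI : ∀ t, ∫ z : E, Real.exp (-(‖z‖ ^ 2 / 2)) * (q z).partialSum N t =
      ∑ s ∈ Finset.range (N + 1), (∫ z : E, Real.exp (-(‖z‖ ^ 2 / 2)) *
        PowerSeries.coeff s (q z)) * t ^ s := by
    intro t
    simp only [PowerSeries.partialSum, Finset.mul_sum, ← mul_assoc]
    rw [integral_finsetSum _ fun s _ => (hqi s).mul_const (t ^ s)]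
    simp only [integral_mul_const]
  have hgauss : Integrable fun z : E => C * Real.exp (-(‖z‖ ^ 2 / 8)) :=
    integrable_exp_neg_norm_sq_div_eight.const_mul C
  have hdiffI : ∀ t, 0 < t → t ≤ 1 → Integrable fun z : E =>
      I t z - Real.exp (-(‖z‖ ^ 2 / 2)) * (q z).partialSum N t := by
    intro t h0 h1
    refine (hgauss.const_mul (t ^ N)).mono' ((hmeasI t h0).sub (hpsi t).1)
      (Eventually.of_forall fun z => (hdom t z h0 h1).trans ?_)
    exact mul_le_mul_of_nonneg_left (hC z) (by positivity)
  have hev : ∀ᶠ t in 𝓝[>] (0 : ℝ), t ∈ Set.Ioc (0 : ℝ) 1 := Ioc_mem_nhdsGT zero_lt_one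
  -- Dominated convergence for the error divided by `t ^ N`; the majorant does not depend on `t`.
  have hmain : Tendsto (fun t : ℝ => ∫ z : E,
      (I t z - Real.exp (-(‖z‖ ^ 2 / 2)) * (q z).partialSum N t) / t ^ N) (𝓝[>] 0)
      (𝓝 (∫ _ : E, (0 : ℝ))) := by
    refine tendsto_integral_filter_of_dominated_convergence
      (fun z => C * Real.exp (-(‖z‖ ^ 2 / 8))) ?_ ?_ hgauss ?_
    · filter_upwards [hev] with t ht
      exact ((hdiffI t ht.1 ht.2).div_const _).1
    · filter_upwards [hev] with t ht
      refine Eventually.of_forall fun z => ?_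
      rw [norm_div, norm_pow, Real.norm_of_nonneg ht.1.le, div_le_iff₀ (pow_pos ht.1 N),
        mul_comm _ (t ^ N)]
      exact (hdom t z ht.1 ht.2).trans
        (mul_le_mul_of_nonneg_left (hC z) (pow_nonneg ht.1.le N))
    · exact Eventually.of_forall fun z => (hpoint z).tendsto_div_nhds_zero
  rw [integral_zero] at hmain
  rw [isLittleO_iff_tendsto' (by
    filter_upwards [hev] with t ht h
    exact absurd h (pow_pos ht.1 N).ne')]
  refine hmain.congr' ?_
  filter_upwards [hev] with t ht
  have hIi : Integrable (I t) := by
    have := (hdiffI t ht.1 ht.2).add (hpsi t)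
    refine this.congr (Eventually.of_forall fun z => ?_)
    simp
  rw [integral_div, integral_sub hIi (hpsi t), hpsiI]

end LaplaceCore

/-! ### Scaled expansions from Taylor's formula -/

section TaylorExpansion

variable {E : Type*} [NormedAddCommGroup E] [NormedSpace ℝ E]

/-- The homogeneous Taylor term of degree `n` of `h` at `0`. -/
noncomputable def taylorTerm (h : E → ℝ) (n : ℕ) (z : E) : ℝ :=
  (n ! : ℝ)⁻¹ * iteratedFDeriv ℝ n h 0 fun _ => z

theorem taylorTerm_smul (h : E → ℝ) (n : ℕ) (t : ℝ) (z : E) :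
    taylorTerm h n (t • z) = taylorTerm h n z * t ^ n := by
  have := (iteratedFDeriv ℝ n h 0).map_smul_univ (fun _ => t) (fun _ => z)
  rw [taylorTerm, taylorTerm, this]
  simp
  ring

theorem continuous_taylorTerm (h : E → ℝ) (n : ℕ) : Continuous (taylorTerm h n) :=
  continuous_const.mul ((iteratedFDeriv ℝ n h 0).cont.comp (by fun_prop))

theorem polyBounded_taylorTerm (h : E → ℝ) (n : ℕ) : PolyBounded (taylorTerm h n) := by
  refine ((PolyBounded.const ((n ! : ℝ)⁻¹ * ‖iteratedFDeriv ℝ n h 0‖)).mul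
    (PolyBounded.norm_pow n)).mono fun z => ?_
  have h1 := (iteratedFDeriv ℝ n h 0).le_opNorm (fun _ => z)
  rw [Finset.prod_const, Finset.card_univ, Fintype.card_fin, Real.norm_eq_abs] at h1
  rw [taylorTerm, abs_mul, abs_of_nonneg (by positivity : (0 : ℝ) ≤ (n ! : ℝ)⁻¹),
    abs_of_nonneg (by positivity : (0 : ℝ) ≤ _ * ‖z‖ ^ n), mul_assoc]
  gcongr

theorem exists_taylor_remainder_bound {h : E → ℝ} {n : ℕ} (hh : ContDiffAt ℝ n h 0) :
    ∃ δ > 0, (∀ y ∈ Metric.ball (0 : E) δ,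
      |h y - ∑ k ∈ Finset.range (n + 1), taylorTerm h k y| ≤ ‖y‖ ^ n) := by
  have := (taylor_isLittleO_iteratedFDeriv hh).bound one_pos
  obtain ⟨δ, hδ, hb⟩ := Metric.eventually_nhds_iff_ball.1 this
  refine ⟨δ, hδ, fun y hy => ?_⟩
  simpa [taylorTerm] using hb y hy

theorem taylor_isLittleO_smul {h : E → ℝ} {n : ℕ} (hh : ContDiffAt ℝ n h 0) (z : E) :
    (fun t : ℝ => h (t • z) - ∑ k ∈ Finset.range (n + 1), taylorTerm h k z * t ^ k)
      =o[𝓝[>] 0] fun t : ℝ => t ^ n := by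
  have h1 := taylor_isLittleO_iteratedFDeriv hh
  have ht : Tendsto (fun t : ℝ => t • z) (𝓝[>] 0) (𝓝 0) := by
    have : ContinuousAt (fun t : ℝ => t • z) 0 := by fun_prop
    simpa [ContinuousAt] using this.tendsto.mono_left nhdsWithin_le_nhds
  have h2 := h1.comp_tendsto ht
  have h3 : ((fun y : E => ‖y‖ ^ n) ∘ fun t : ℝ => t • z) =O[𝓝[>] 0] fun t : ℝ => t ^ n := by
    refine IsBigO.of_bound (‖z‖ ^ n) (Eventually.of_forall fun t => ?_)
    simp [norm_smul, mul_pow, mul_comm]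
  refine (h2.trans_isBigO h3).congr_left fun t => ?_
  simp only [Function.comp_apply, zero_add, ← taylorTerm_smul]
  rfl

theorem exists_hasScaledExpansion_smul {h : E → ℝ} {N : ℕ} (hh : ContDiffAt ℝ N h 0) :
    ∃ δ₀ > 0, ∀ δ ≤ δ₀, HasScaledExpansion δ N (fun t z => h (t • z))
      (fun z => PowerSeries.mk fun n => taylorTerm h n z) := by
  obtain ⟨δ₀, hδ₀, hb⟩ := exists_taylor_remainder_bound hh
  refine ⟨δ₀, hδ₀, fun δ hδ => ⟨fun s => ?_, fun s => ?_, ?_, fun z => ?_⟩⟩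
  · simpa using continuous_taylorTerm h s
  · simpa using polyBounded_taylorTerm h s
  · refine ⟨fun z => ‖z‖ ^ N, PolyBounded.norm_pow N, fun t z h0 _ hz => ?_⟩
    have hn : ‖t • z‖ = t * ‖z‖ := by rw [norm_smul, Real.norm_of_nonneg h0.le]
    have := hb (t • z) (by rw [mem_ball_zero_iff, hn]; linarith)
    simpa [taylorTerm_smul, PowerSeries.partialSum, hn, mul_pow] using this
  · simpa [PowerSeries.partialSum] using taylor_isLittleO_smul hh z

/-- Division by `t²` lowers the order from `N + 2` to `N`. The terms of degree 0 and 1 vanish and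
the quadratic one cancels `‖z‖² / 2`, so the coefficient of index 0 is zero. -/
theorem exists_hasScaledExpansion_div_sq {h : E → ℝ} {N : ℕ}
    (hh : ContDiffAt ℝ ((N + 2 : ℕ) : WithTop ℕ∞) h 0)
    (h0 : ∀ z, taylorTerm h 0 z = 0) (h1 : ∀ z, taylorTerm h 1 z = 0)
    (h2 : ∀ z, taylorTerm h 2 z = ‖z‖ ^ 2 / 2) :
    ∃ δ₀ > 0, ∀ δ ≤ δ₀, HasScaledExpansion δ N (fun t z => h (t • z) / t ^ 2 - ‖z‖ ^ 2 / 2)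
      (fun z => PowerSeries.mk fun n => if n = 0 then 0 else taylorTerm h (n + 2) z) := by
  obtain ⟨δ₀, hδ₀, hb⟩ := exists_taylor_remainder_bound hh
  have key : ∀ (t : ℝ) (z : E), 0 < t → h (t • z) / t ^ 2 - ‖z‖ ^ 2 / 2 -
      (PowerSeries.mk fun n => if n = 0 then 0 else taylorTerm h (n + 2) z).partialSum N t =
      (h (t • z) - ∑ k ∈ Finset.range (N + 2 + 1), taylorTerm h k z * t ^ k) / t ^ 2 := by
    intro t z ht
    have e1 : ∑ k ∈ Finset.range (N + 2 + 1), taylorTerm h k z * t ^ k =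
        t ^ 2 * (∑ k ∈ Finset.range N, taylorTerm h (k + 1 + 2) z * t ^ (k + 1) +
          ‖z‖ ^ 2 / 2) := by
      rw [Finset.sum_range_succ', Finset.sum_range_succ', Finset.sum_range_succ', mul_add,
        Finset.mul_sum]
      simp only [zero_add, h0, h1, h2, zero_mul, add_zero, Nat.reduceAdd]
      rw [mul_comm (t ^ 2)]
      congr 1
      exact Finset.sum_congr rfl fun k _ => by ring
    rw [e1, PowerSeries.partialSum, Finset.sum_range_succ']
    simp only [PowerSeries.coeff_mk, Nat.add_eq_zero_iff, one_ne_zero, and_false, if_false, if_true,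
      zero_mul, add_zero]
    field_simp
    ring
  refine ⟨δ₀, hδ₀, fun δ hδ => ⟨fun s => ?_, fun s => ?_, ?_, fun z => ?_⟩⟩
  · by_cases hs : s = 0
    · simpa [hs] using continuous_const
    · simpa [hs] using continuous_taylorTerm h (s + 2)
  · by_cases hs : s = 0
    · simpa [hs] using PolyBounded.const 0
    · simpa [hs] using polyBounded_taylorTerm h (s + 2)
  · refine ⟨fun z => ‖z‖ ^ (N + 2), PolyBounded.norm_pow _, fun t z ht _ hz => ?_⟩
    have hn : ‖t • z‖ = t * ‖z‖ := by rw [norm_smul, Real.norm_of_nonneg ht.le]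
    have := hb (t • z) (by rw [mem_ball_zero_iff, hn]; linarith)
    simp only [taylorTerm_smul, hn] at this
    rw [key t z ht, abs_div, abs_of_pos (pow_pos ht 2), div_le_iff₀ (pow_pos ht 2)]
    refine this.trans (le_of_eq ?_)
    ring
  · have h3 := (taylor_isLittleO_smul hh z).mul_isBigO
      (isBigO_refl (fun t : ℝ => (t ^ 2)⁻¹) (𝓝[>] 0))
    refine h3.congr' ?_ ?_
    · filter_upwards [self_mem_nhdsWithin] with t ht
      rw [key t z ht]
      rfl
    · filter_upwards [self_mem_nhdsWithin] with t ht
      have : t ≠ 0 := ne_of_gt ht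
      field_simp
      ring

/-- The second order Peano remainder with constant `1 / 4` keeps the phase comparable to its
quadratic part, as the Gaussian majorant needs. -/
theorem exists_abs_sub_norm_sq_le {h : E → ℝ} (hh : ContDiffAt ℝ 2 h 0)
    (h0 : ∀ z, taylorTerm h 0 z = 0) (h1 : ∀ z, taylorTerm h 1 z = 0)
    (h2 : ∀ z, taylorTerm h 2 z = ‖z‖ ^ 2 / 2) :
    ∃ δ > 0, ∀ y ∈ Metric.ball (0 : E) δ, |h y - ‖y‖ ^ 2 / 2| ≤ ‖y‖ ^ 2 / 4 := by
  have := (taylor_isLittleO_iteratedFDeriv (n := 2) hh).bound (c := 1 / 4) (by norm_num)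
  obtain ⟨δ, hδ, hb⟩ := Metric.eventually_nhds_iff_ball.1 this
  refine ⟨δ, hδ, fun y hy => ?_⟩
  have hy' := hb y hy
  have e : ∑ k ∈ Finset.range (2 + 1), (k ! : ℝ)⁻¹ * iteratedFDeriv ℝ k h 0 (fun _ => y) =
      ‖y‖ ^ 2 / 2 := by
    have : ∑ k ∈ Finset.range (2 + 1), taylorTerm h k y = ‖y‖ ^ 2 / 2 := by
      simp [Finset.sum_range_succ, h0, h1, h2]
    exact this
  rw [e, zero_add, Real.norm_eq_abs, norm_pow, norm_norm] at hy'
  linarith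

end TaylorExpansion

/-! ### Identification of the coefficients -/

section Coefficients

open LaplaceExpansion MeasureTheory

variable {d : ℕ}

theorem PowerSeries.coeff_prod_eq_sum_piAntidiag {ι : Type*} [Fintype ι] [DecidableEq ι]
    (p : ι → PowerSeries ℝ) (m : ℕ) :
    PowerSeries.coeff m (∏ i, p i) =
      ∑ n ∈ (Finset.univ : Finset ι).piAntidiag m, ∏ i, PowerSeries.coeff (n i) (p i) := by
  rw [PowerSeries.coeff_prod]
  refine Finset.sum_bij' (fun l _ => ⇑l) (fun n _ => Finsupp.equivFunOnFinite.symm n) ?_ ?_ ?_ ?_ ?_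
  · intro l hl
    simpa [Finset.mem_finsuppAntidiag] using hl
  · intro n hn
    simpa [Finset.mem_finsuppAntidiag] using hn
  · intro l _
    ext
    simp
  · intro n _
    ext
    simp
  · intro l _
    rfl

/-- A tuple with an entry `0` contributes nothing because `p` has no constant term. -/
theorem PowerSeries.coeff_pow_eq_sum_compositions {p : PowerSeries ℝ}
    (hp : PowerSeries.coeff 0 p = 0) (r m : ℕ) :
    PowerSeries.coeff m (p ^ r) = ∑ n ∈ compositions r m, ∏ i, PowerSeries.coeff (n i) p := by
  have h : p ^ r = ∏ _i : Fin r, p := by simp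
  rw [h, PowerSeries.coeff_prod_eq_sum_piAntidiag, compositions, Finset.sum_filter]
  refine Finset.sum_congr rfl fun n _ => ?_
  split_ifs with hn
  · rfl
  · push Not at hn
    obtain ⟨i, hi⟩ := hn
    refine Finset.prod_eq_zero (Finset.mem_univ i) ?_
    rw [show n i = 0 by omega, hp]

theorem compositions_eq_empty {r m : ℕ} (h : m < r) : compositions r m = ∅ := by
  rw [compositions, Finset.filter_eq_empty_iff]
  intro n hn hpos
  have h1 : ∑ i, n i = m := (Finset.mem_piAntidiag.1 hn).1
  have h2 : ∑ _i : Fin r, 1 ≤ ∑ i, n i := Finset.sum_le_sum fun i _ => hpos i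
  simp at h2
  omega

/-- As `a ^ r` starts in degree at least `r`, only `r ≤ m` contributes in degree `m`; truncating the
exponential series at `N` is therefore invisible for `s ≤ N`. -/
theorem PowerSeries.coeff_expNegMul {N s : ℕ} (hs : s ≤ N) {a γ : PowerSeries ℝ}
    (ha : PowerSeries.coeff 0 a = 0) :
    PowerSeries.coeff s (a.expNegMul N γ) =
      ∑ m ∈ Finset.range (s + 1), ∑ r ∈ Finset.range (m + 1), ((-1 : ℝ) ^ r / (r ! : ℝ)) *
        (PowerSeries.coeff (s - m) γ *
          ∑ n ∈ compositions r m, ∏ i, PowerSeries.coeff (n i) a) := by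
  rw [expNegMul, PowerSeries.coeff_mul, Finset.Nat.sum_antidiagonal_eq_sum_range_succ_mk]
  refine Finset.sum_congr rfl fun m hm => ?_
  have hm' := Finset.mem_range.1 hm
  rw [map_sum, Finset.sum_mul]
  have hsub : Finset.range (m + 1) ⊆ Finset.range (N + 1) :=
    Finset.range_subset_range.2 (by omega)
  rw [← Finset.sum_subset hsub]
  · refine Finset.sum_congr rfl fun r _ => ?_
    rw [PowerSeries.coeff_C_mul, PowerSeries.coeff_pow_eq_sum_compositions ha]
    ring
  · intro r _ hr
    rw [Finset.mem_range, not_lt] at hr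
    rw [PowerSeries.coeff_C_mul, PowerSeries.coeff_pow_eq_sum_compositions ha,
      compositions_eq_empty (by omega)]
    simp

/-- The Taylor terms are expanded into monomials, whose exponents add to `β + ∑ i, α i`, and each
monomial is integrated as a Gaussian moment. Only the factor `1 / √(det H)` of `coeff` is missing.
-/
theorem integral_gaussian_mul_coeff_expNegMul {N s : ℕ} (hs : s ≤ N)
    {F G : EuclideanSpace ℝ (Fin d) → ℝ}
    (hF : ContDiffAt ℝ ((N + 2 : ℕ) : WithTop ℕ∞) F 0) (hG : ContDiffAt ℝ N G 0) :
    ∫ z : EuclideanSpace ℝ (Fin d), Real.exp (-(‖z‖ ^ 2 / 2)) * PowerSeries.coeff s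
      ((PowerSeries.mk fun n => if n = 0 then 0 else taylorTerm F (n + 2) z).expNegMul N
        (PowerSeries.mk fun n => taylorTerm G n z)) =
    (2 * Real.pi) ^ ((d : ℝ) / 2) *
    ∑ m ∈ Finset.range (s + 1), ∑ r ∈ Finset.range (m + 1), ((-1 : ℝ) ^ r / (r ! : ℝ)) *
      ∑ β ∈ multiIndices d (s - m), ∑ n ∈ compositions r m,
        ∑ α ∈ Fintype.piFinset (fun i : Fin r => multiIndices d (n i + 2)),
          even (β + ∑ i, α i) *
            ((doubleFactorialSubOne (β + ∑ i, α i) : ℝ) /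
              ((multiFactorial β : ℝ) * ∏ i, (multiFactorial (α i) : ℝ))) *
            (mixedPartial β G 0 * ∏ i, mixedPartial (α i) F 0) := by
  have hterm : ∀ (H : EuclideanSpace ℝ (Fin d) → ℝ) (M n : ℕ), n ≤ M →
      ContDiffAt ℝ (M : WithTop ℕ∞) H 0 → ∀ z, taylorTerm H n z =
      ∑ α ∈ multiIndices d n, mixedPartial α H 0 / multiFactorial α * ∏ i, z i ^ α i :=
    fun H M n hn hH z => iteratedFDeriv_diag_eq_sum_mixedPartial
      (hH.of_le (by exact_mod_cast hn)) z
  have hprod : ∀ m ≤ s, ∀ r, ∀ n ∈ compositions r m, ∀ z,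
      taylorTerm G (s - m) z * ∏ i, (if n i = 0 then 0 else taylorTerm F (n i + 2) z) =
      ∑ β ∈ multiIndices d (s - m),
        ∑ α ∈ Fintype.piFinset (fun i : Fin r => multiIndices d (n i + 2)),
          (1 / ((multiFactorial β : ℝ) * ∏ i, (multiFactorial (α i) : ℝ)) *
            (mixedPartial β G 0 * ∏ i, mixedPartial (α i) F 0)) *
            ∏ j, z j ^ (β + ∑ i, α i) j := by
    intro m hm r n hn z
    rw [compositions, Finset.mem_filter, Finset.mem_piAntidiag] at hn
    have hle : ∀ i, n i ≤ m := fun i => by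
      rw [← hn.1.1]
      exact Finset.single_le_sum (fun _ _ => Nat.zero_le _) (Finset.mem_univ i)
    have h1 : ∀ i, (if n i = 0 then 0 else taylorTerm F (n i + 2) z) =
        ∑ α ∈ multiIndices d (n i + 2),
          mixedPartial α F 0 / multiFactorial α * ∏ j, z j ^ α j := fun i => by
      rw [if_neg (by have := hn.2 i; omega)]
      exact hterm F (N + 2) _ (by have := hle i; omega) hF z
    rw [Finset.prod_congr rfl fun i _ => h1 i, Finset.prod_univ_sum,
      hterm G N _ (by omega) hG z, Finset.sum_mul_sum]
    refine Finset.sum_congr rfl fun β _ => Finset.sum_congr rfl fun α _ => ?_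
    have h2 : ∏ j, z j ^ (β + ∑ i, α i) j = (∏ j, z j ^ β j) * ∏ i, ∏ j, z j ^ α i j := by
      rw [Finset.prod_comm, ← Finset.prod_mul_distrib]
      refine Finset.prod_congr rfl fun j _ => ?_
      rw [Pi.add_apply, pow_add, Finset.sum_apply, Finset.prod_pow_eq_pow_sum]
    rw [h2, Finset.prod_mul_distrib, Finset.prod_div_distrib, one_div, mul_inv]
    ring
  have hmono : ∀ α : Fin d → ℕ, Integrable fun z : EuclideanSpace ℝ (Fin d) =>
      Real.exp (-(‖z‖ ^ 2 / 2)) * ∏ j, z j ^ α j := by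
    intro α
    refine PolyBounded.integrable_mul_exp ?_ (by fun_prop)
    refine (PolyBounded.norm_pow (∑ j, α j)).mono fun z => ?_
    rw [Finset.abs_prod, abs_of_nonneg (by positivity), ← Finset.prod_pow_eq_pow_sum]
    refine Finset.prod_le_prod (fun _ _ => abs_nonneg _) fun j _ => ?_
    rw [abs_pow]
    exact pow_le_pow_left₀ (abs_nonneg _) (PiLp.norm_apply_le z j) _
  have hcoeff : ∀ z : EuclideanSpace ℝ (Fin d), Real.exp (-(‖z‖ ^ 2 / 2)) * PowerSeries.coeff s
      ((PowerSeries.mk fun n => if n = 0 then 0 else taylorTerm F (n + 2) z).expNegMul N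
        (PowerSeries.mk fun n => taylorTerm G n z)) =
      ∑ m ∈ Finset.range (s + 1), ∑ r ∈ Finset.range (m + 1),
        ∑ β ∈ multiIndices d (s - m), ∑ n ∈ compositions r m,
        ∑ α ∈ Fintype.piFinset (fun i : Fin r => multiIndices d (n i + 2)),
          ((-1 : ℝ) ^ r / (r ! : ℝ)) *
          (1 / ((multiFactorial β : ℝ) * ∏ i, (multiFactorial (α i) : ℝ)) *
            (mixedPartial β G 0 * ∏ i, mixedPartial (α i) F 0)) *
            (Real.exp (-(‖z‖ ^ 2 / 2)) * ∏ j, z j ^ (β + ∑ i, α i) j) := by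
    intro z
    rw [PowerSeries.coeff_expNegMul hs (by simp), Finset.mul_sum]
    refine Finset.sum_congr rfl fun m hm => ?_
    rw [Finset.mul_sum]
    refine Finset.sum_congr rfl fun r _ => ?_
    simp only [PowerSeries.coeff_mk]
    rw [Finset.mul_sum (compositions r m), Finset.sum_congr rfl fun n hn =>
      hprod m (by have := Finset.mem_range.1 hm; omega) r n hn z, Finset.sum_comm]
    simp only [Finset.mul_sum]
    refine Finset.sum_congr rfl fun β _ => Finset.sum_congr rfl fun n _ =>
      Finset.sum_congr rfl fun α _ => ?_
    ring
  simp_rw [hcoeff]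
  have hi : ∀ (c : ℝ) (α : Fin d → ℕ), Integrable fun z : EuclideanSpace ℝ (Fin d) =>
      c * (Real.exp (-(‖z‖ ^ 2 / 2)) * ∏ j, z j ^ α j) := fun c α => (hmono α).const_mul c
  rw [integral_finsetSum _ fun m _ => integrable_finsetSum _ fun r _ =>
    integrable_finsetSum _ fun β _ => integrable_finsetSum _ fun n _ =>
    integrable_finsetSum _ fun α _ => hi _ _, Finset.mul_sum]
  refine Finset.sum_congr rfl fun m _ => ?_
  rw [integral_finsetSum _ fun r _ =>
    integrable_finsetSum _ fun β _ => integrable_finsetSum _ fun n _ =>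
    integrable_finsetSum _ fun α _ => hi _ _, Finset.mul_sum]
  refine Finset.sum_congr rfl fun r _ => ?_
  rw [integral_finsetSum _ fun β _ => integrable_finsetSum _ fun n _ =>
    integrable_finsetSum _ fun α _ => hi _ _, Finset.mul_sum, Finset.mul_sum]
  refine Finset.sum_congr rfl fun β _ => ?_
  rw [integral_finsetSum _ fun n _ => integrable_finsetSum _ fun α _ => hi _ _,
    Finset.mul_sum, Finset.mul_sum]
  refine Finset.sum_congr rfl fun n _ => ?_
  rw [integral_finsetSum _ fun α _ => hi _ _, Finset.mul_sum, Finset.mul_sum]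
  refine Finset.sum_congr rfl fun α _ => ?_
  rw [integral_const_mul, integral_exp_neg_norm_sq_mul_prod_pow]
  ring

/-- The exponent `β + ∑ i, α i` has total degree `(s - m) + (m + 2 r) = s + 2 r`, which is odd with
`s`, so some component is odd. -/
theorem coeff_eq_zero_of_odd (f g : EuclideanSpace ℝ (Fin d) → ℝ)
    (P : EuclideanSpace ℝ (Fin d) ≃L[ℝ] EuclideanSpace ℝ (Fin d)) {s : ℕ} (hs : Odd s) :
    coeff f g P s = 0 := by
  rw [coeff]
  refine mul_eq_zero_of_right _ (Finset.sum_eq_zero fun m hm => Finset.sum_eq_zero fun r _ =>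
    mul_eq_zero_of_right _ (Finset.sum_eq_zero fun β hβ => Finset.sum_eq_zero fun n hn =>
    Finset.sum_eq_zero fun α hα => ?_))
  have hodd : ¬ ∀ j, Even ((β + ∑ i, α i) j) := by
    intro he
    have h1 : Even (∑ j, (β + ∑ i, α i) j) := Finset.even_sum _ fun j _ => he j
    have h2 : ∑ j, β j = s - m := (Finset.mem_piAntidiag.1 hβ).1
    have h3 : ∀ i, ∑ j, α i j = n i + 2 := fun i =>
      (Finset.mem_piAntidiag.1 (Fintype.mem_piFinset.1 hα i)).1
    have h4 : ∑ i, n i = m := (Finset.mem_piAntidiag.1 (Finset.mem_filter.1 hn).1).1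
    have h5 : ∑ j, (β + ∑ i, α i) j = s + 2 * r := by
      simp only [Pi.add_apply, Finset.sum_apply]
      rw [Finset.sum_add_distrib, Finset.sum_comm, h2, Finset.sum_congr rfl fun i _ => h3 i,
        Finset.sum_add_distrib, h4]
      have := Finset.mem_range.1 hm
      simp
      omega
    rw [h5] at h1
    rw [Nat.odd_iff] at hs
    rw [Nat.even_iff] at h1
    omega
  rw [even, if_neg hodd]
  ring

end Coefficients

/-! ### The Hessian and the normalizing coordinates -/

section Hessian

open LaplaceExpansion Matrix

variable {d : ℕ}

theorem fderiv_fderiv_eq_sum_hessian (h : EuclideanSpace ℝ (Fin d) → ℝ)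
    (x v w : EuclideanSpace ℝ (Fin d)) :
    fderiv ℝ (fderiv ℝ h) x v w = ∑ i, ∑ j, v i * hessian h x i j * w j := by
  have hH : ∀ i j, hessian h x i j = fderiv ℝ (fderiv ℝ h) x (EuclideanSpace.single i 1)
      (EuclideanSpace.single j 1) := fun i j => by
    rw [hessian, Matrix.of_apply, iteratedFDeriv_two_apply]
    rfl
  conv_lhs => rw [← EuclideanSpace.sum_smul_single v, ← EuclideanSpace.sum_smul_single w]
  simp only [map_sum, map_smul, _root_.sum_apply, _root_.smul_apply,
    smul_eq_mul, hH, Finset.mul_sum]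
  rw [Finset.sum_comm]
  exact Finset.sum_congr rfl fun i _ => Finset.sum_congr rfl fun j _ => by ring

theorem taylorTerm_two_eq_sum_hessian (h : EuclideanSpace ℝ (Fin d) → ℝ)
    (z : EuclideanSpace ℝ (Fin d)) :
    taylorTerm h 2 z = (∑ i, ∑ j, z i * hessian h 0 i j * z j) / 2 := by
  rw [taylorTerm, iteratedFDeriv_two_apply, fderiv_fderiv_eq_sum_hessian]
  simp [div_eq_inv_mul]

theorem taylorTerm_two_of_hessian_eq_one {h : EuclideanSpace ℝ (Fin d) → ℝ}
    (hh : hessian h 0 = 1) (z : EuclideanSpace ℝ (Fin d)) :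
    taylorTerm h 2 z = ‖z‖ ^ 2 / 2 := by
  rw [taylorTerm_two_eq_sum_hessian, hh, EuclideanSpace.real_norm_sq_eq]
  congr 1
  refine Finset.sum_congr rfl fun i _ => ?_
  simp [Matrix.one_apply, sq]

/-- The matrix of a linear map in the standard basis. -/
noncomputable def stdMatrix (L : EuclideanSpace ℝ (Fin d) →ₗ[ℝ] EuclideanSpace ℝ (Fin d)) :
    Matrix (Fin d) (Fin d) ℝ :=
  LinearMap.toMatrix (EuclideanSpace.basisFun (Fin d) ℝ).toBasis
    (EuclideanSpace.basisFun (Fin d) ℝ).toBasis L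

theorem stdMatrix_apply (L : EuclideanSpace ℝ (Fin d) →ₗ[ℝ] EuclideanSpace ℝ (Fin d))
    (i j : Fin d) : stdMatrix L i j = L (EuclideanSpace.single j 1) i := by
  simp [stdMatrix, LinearMap.toMatrix_apply]

theorem hessian_comp_continuousLinearEquiv (h : EuclideanSpace ℝ (Fin d) → ℝ)
    (L : EuclideanSpace ℝ (Fin d) ≃L[ℝ] EuclideanSpace ℝ (Fin d)) :
    hessian (h ∘ L) 0 = (stdMatrix L.toLinearMap)ᵀ * hessian h 0 * stdMatrix L.toLinearMap := by
  have h1 : iteratedFDeriv ℝ 2 (h ∘ L) 0 =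
      (iteratedFDeriv ℝ 2 h 0).compContinuousLinearMap
        fun _ => (L : EuclideanSpace ℝ (Fin d) →L[ℝ] EuclideanSpace ℝ (Fin d)) := by
    have := L.iteratedFDerivWithin_comp_right h uniqueDiffOn_univ (x := 0) (Set.mem_univ _) 2
    simpa [iteratedFDerivWithin_univ] using this
  ext i j
  rw [hessian, Matrix.of_apply, h1, ContinuousMultilinearMap.compContinuousLinearMap_apply,
    iteratedFDeriv_two_apply, fderiv_fderiv_eq_sum_hessian, Finset.sum_comm, Matrix.mul_apply]
  refine Finset.sum_congr rfl fun l _ => ?_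
  rw [Matrix.mul_apply, Finset.sum_mul]
  refine Finset.sum_congr rfl fun k _ => ?_
  simp [stdMatrix_apply]

/-- Taking determinants in `Lᵀ H L = 1` gives `(det L)² det H = 1`. -/
theorem abs_det_eq_of_hessian_comp_eq_one {h : EuclideanSpace ℝ (Fin d) → ℝ}
    {L : EuclideanSpace ℝ (Fin d) ≃L[ℝ] EuclideanSpace ℝ (Fin d)}
    (hL : hessian (h ∘ L) 0 = 1) :
    |LinearMap.det L.toLinearMap| = (√(hessian h 0).det)⁻¹ := by
  rw [hessian_comp_continuousLinearEquiv] at hL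
  have h1 := congrArg Matrix.det hL
  have h2 : (stdMatrix L.toLinearMap).det = LinearMap.det L.toLinearMap :=
    LinearMap.det_toMatrix _ _
  rw [Matrix.det_mul, Matrix.det_mul, Matrix.det_transpose, Matrix.det_one, h2] at h1
  have h3 : (hessian h 0).det = (LinearMap.det L.toLinearMap ^ 2)⁻¹ := by
    refine eq_inv_of_mul_eq_one_left ?_
    linarith
  rw [h3, Real.sqrt_inv, Real.sqrt_sq_eq_abs, inv_inv]

theorem taylorTerm_zero (h : EuclideanSpace ℝ (Fin d) → ℝ) (z : EuclideanSpace ℝ (Fin d)) :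
    taylorTerm h 0 z = h 0 := by
  simp [taylorTerm]

theorem taylorTerm_one_of_isLocalMin {h : EuclideanSpace ℝ (Fin d) → ℝ} (hmin : IsLocalMin h 0)
    (z : EuclideanSpace ℝ (Fin d)) : taylorTerm h 1 z = 0 := by
  simp [taylorTerm, iteratedFDeriv_one_apply, hmin.fderiv_eq_zero]

/-- At a minimum of value zero, this term is the limit of the quotients `h (t z) / t²`, which are
nonnegative for small `t > 0`. -/
theorem taylorTerm_two_nonneg {h : EuclideanSpace ℝ (Fin d) → ℝ} (hh : ContDiffAt ℝ 2 h 0)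
    (h0 : h 0 = 0) (hmin : IsLocalMin h 0) (z : EuclideanSpace ℝ (Fin d)) :
    0 ≤ taylorTerm h 2 z := by
  have h1 := (taylor_isLittleO_smul (n := 2) hh z).tendsto_div_nhds_zero
  have h2 : Tendsto (fun t : ℝ => h (t • z) / t ^ 2) (𝓝[>] 0) (𝓝 (taylorTerm h 2 z)) := by
    have h3 := h1.add_const (taylorTerm h 2 z)
    rw [zero_add] at h3
    refine h3.congr' ?_
    filter_upwards [self_mem_nhdsWithin] with t ht
    have ht0 : t ≠ 0 := ne_of_gt ht
    simp only [Finset.sum_range_succ, Finset.sum_range_zero, taylorTerm_zero, h0,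
      taylorTerm_one_of_isLocalMin hmin]
    field_simp
    ring
  have ht : Tendsto (fun t : ℝ => t • z) (𝓝[>] 0) (𝓝 0) := by
    have : ContinuousAt (fun t : ℝ => t • z) 0 := by fun_prop
    simpa [ContinuousAt] using this.tendsto.mono_left nhdsWithin_le_nhds
  refine ge_of_tendsto h2 ?_
  filter_upwards [ht.eventually hmin] with t ht
  rw [h0] at ht
  positivity

-- The Hessian at a minimum is positive semidefinite, hence of the form `Bᵀ B`. Nondegeneracy makes
-- `B` invertible, and `P⁻¹ = B⁻¹` turns it into the identity.
open scoped MatrixOrder in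
theorem exists_hessian_comp_symm_eq_one {h : EuclideanSpace ℝ (Fin d) → ℝ}
    (hh : ContDiffAt ℝ 2 h 0) (h0 : h 0 = 0) (hmin : IsLocalMin h 0)
    (hdet : (hessian h 0).det ≠ 0) :
    ∃ P : EuclideanSpace ℝ (Fin d) ≃L[ℝ] EuclideanSpace ℝ (Fin d),
      hessian (h ∘ P.symm) 0 = 1 := by
  have hherm : (hessian h 0).IsHermitian := by
    ext i j
    simp only [Matrix.conjTranspose_apply, star_trivial, hessian, Matrix.of_apply,
      iteratedFDeriv_two_apply]
    exact hh.isSymmSndFDerivAt (by simp) _ _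
  have hpsd : (hessian h 0).PosSemidef := by
    refine Matrix.PosSemidef.of_dotProduct_mulVec_nonneg hherm fun x => ?_
    have h1 := taylorTerm_two_nonneg hh h0 hmin (WithLp.toLp 2 x)
    rw [taylorTerm_two_eq_sum_hessian] at h1
    have h2 : star x ⬝ᵥ (hessian h 0) *ᵥ x = ∑ i, ∑ j, x i * hessian h 0 i j * x j := by
      simp [dotProduct, Matrix.mulVec, Finset.mul_sum, mul_assoc]
    rw [h2]
    simp only at h1
    linarith
  obtain ⟨B, hB⟩ := CStarAlgebra.nonneg_iff_eq_star_mul_self.1 (Matrix.nonneg_iff_posSemidef.2 hpsd)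
  have hBdet : IsUnit B.det := by
    rw [isUnit_iff_ne_zero]
    intro hz
    apply hdet
    rw [hB, Matrix.det_mul, hz, mul_zero]
  let b := (EuclideanSpace.basisFun (Fin d) ℝ).toBasis
  have hunit : IsUnit (LinearMap.toMatrix b b (Matrix.toLin b b B⁻¹)).det := by
    rw [LinearMap.toMatrix_toLin]
    exact (Matrix.isUnit_nonsing_inv_det_iff).2 hBdet
  let L := (LinearEquiv.ofIsUnitDet hunit).toContinuousLinearEquiv
  have hL : stdMatrix L.toLinearMap = B⁻¹ := LinearMap.toMatrix_toLin b b B⁻¹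
  refine ⟨L.symm, ?_⟩
  rw [ContinuousLinearEquiv.symm_symm, hessian_comp_continuousLinearEquiv, hL, hB,
    Matrix.star_eq_conjTranspose, Matrix.conjTranspose_eq_transpose_of_trivial, ← Matrix.mul_assoc,
    ← Matrix.transpose_mul, Matrix.mul_assoc, Matrix.mul_nonsing_inv _ hBdet]
  simp

end Hessian

/-! ### Change of variables and the tail estimate -/

section Integrals

open MeasureTheory

theorem integral_comp_continuousLinearEquiv {E : Type*} [NormedAddCommGroup E] [NormedSpace ℝ E]
    [FiniteDimensional ℝ E] [MeasurableSpace E] [BorelSpace E] (μ : Measure E) [μ.IsAddHaarMeasure]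
    (L : E ≃L[ℝ] E) (ψ : E → ℝ) :
    ∫ x, ψ x ∂μ = |LinearMap.det L.toLinearMap| * ∫ y, ψ (L y) ∂μ := by
  have hdet : LinearMap.det L.toLinearMap ≠ 0 := L.toLinearEquiv.isUnit_det'.ne_zero
  have h1 : ∫ y, ψ (L y) ∂μ = ∫ x, ψ x ∂(μ.map L) :=
    (L.toHomeomorph.measurableEmbedding.integral_map ψ).symm
  have h2 : μ.map L = ENNReal.ofReal |(LinearMap.det L.toLinearMap)⁻¹| • μ :=
    Measure.map_linearMap_addHaar_eq_smul_addHaar μ hdet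
  rw [h1, h2, integral_smul_measure, ENNReal.toReal_ofReal (abs_nonneg _), smul_eq_mul, abs_inv,
    mul_inv_cancel_left₀ (abs_ne_zero.2 hdet)]

theorem sum_range_eq_sum_even {c : ℕ → ℝ} (hc : ∀ s, Odd s → c s = 0) (N : ℕ) :
    ∑ s ∈ Finset.range (N + 1), c s = ∑ j ∈ Finset.range (N / 2 + 1), c (2 * j) := by
  rw [← Finset.sum_image (f := c) (s := Finset.range (N / 2 + 1)) (g := fun j => 2 * j)
    (fun a _ b _ h => by simpa using h)]
  refine (Finset.sum_subset ?_ ?_).symm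
  · intro s hs
    simp only [Finset.mem_image, Finset.mem_range] at hs ⊢
    omega
  · intro s hs hns
    refine hc s ?_
    rw [← Nat.not_even_iff_odd]
    rintro ⟨j, rfl⟩
    refine hns (Finset.mem_image.2 ⟨j, ?_, by ring⟩)
    simp only [Finset.mem_range] at hs ⊢
    omega

/-- Splits off the integrand at `k₀`, known to be integrable; for `k ≥ k₀` the other factor is at
most `1` where `f ≥ 0`, and at most `exp (-(k - k₀) c)` where `f ≥ c`. -/
theorem exp_neg_mul_eq_exp_mul {α : Type*} (f : α → ℝ) (g : α → ℝ) (k k₀ : ℝ) (x : α) :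
    Real.exp (-k * f x) * g x =
      Real.exp (-(k - k₀) * f x) * (Real.exp (-k₀ * f x) * g x) := by
  rw [← mul_assoc, ← Real.exp_add]
  congr 2
  ring

variable {α : Type*} [MeasurableSpace α] {μ : Measure α} {S T : Set α} {f g : α → ℝ} {k₀ : ℝ}

theorem integrableOn_exp_neg_mul (hS : MeasurableSet S)
    (hfm : AEStronglyMeasurable f (μ.restrict S)) (hf0 : ∀ x ∈ S, 0 ≤ f x)
    (hint : IntegrableOn (fun x => Real.exp (-k₀ * f x) * g x) S μ) {k : ℝ} (hk : k₀ ≤ k) :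
    IntegrableOn (fun x => Real.exp (-k * f x) * g x) S μ := by
  simp only [exp_neg_mul_eq_exp_mul f g k k₀]
  refine Integrable.bdd_mul (c := 1) hint
    (Real.continuous_exp.comp_aestronglyMeasurable (hfm.const_mul _)) ?_
  filter_upwards [ae_restrict_mem hS] with x hx
  rw [Real.norm_of_nonneg (Real.exp_nonneg _), Real.exp_le_one_iff]
  nlinarith [hf0 x hx]

theorem abs_setIntegral_exp_neg_mul_le (hT : MeasurableSet T) (hTS : T ⊆ S) {c : ℝ}
    (hfc : ∀ x ∈ T, c ≤ f x)
    (hint : IntegrableOn (fun x => Real.exp (-k₀ * f x) * g x) S μ) {k : ℝ} (hk : k₀ ≤ k) :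
    |∫ x in T, Real.exp (-k * f x) * g x ∂μ| ≤
      Real.exp (-(k - k₀) * c) * ∫ x in S, ‖Real.exp (-k₀ * f x) * g x‖ ∂μ := by
  have hT' := hint.mono_set hTS
  calc |∫ x in T, Real.exp (-k * f x) * g x ∂μ|
      ≤ ∫ x in T, Real.exp (-(k - k₀) * c) * ‖Real.exp (-k₀ * f x) * g x‖ ∂μ := by
        rw [← Real.norm_eq_abs]
        refine norm_integral_le_of_norm_le (hT'.norm.const_mul _) ?_
        filter_upwards [ae_restrict_mem hT] with x hx
        rw [exp_neg_mul_eq_exp_mul f g k k₀, norm_mul, Real.norm_of_nonneg (Real.exp_nonneg _)]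
        gcongr ?_ * _
        exact Real.exp_le_exp.2 (by nlinarith [hfc x hx])
    _ = Real.exp (-(k - k₀) * c) * ∫ x in T, ‖Real.exp (-k₀ * f x) * g x‖ ∂μ :=
        MeasureTheory.integral_const_mul _ _
    _ ≤ _ := by
        refine mul_le_mul_of_nonneg_left ?_ (Real.exp_nonneg _)
        exact setIntegral_mono_set hint.norm (Eventually.of_forall fun _ => norm_nonneg _)
          hTS.eventuallyLE

theorem isLittleO_setIntegral_exp_neg_mul (hT : MeasurableSet T) (hTS : T ⊆ S) {c : ℝ}
    (hc : 0 < c) (hfc : ∀ x ∈ T, c ≤ f x)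
    (hint : IntegrableOn (fun x => Real.exp (-k₀ * f x) * g x) S μ) (p : ℝ) :
    (fun k : ℝ => ∫ x in T, Real.exp (-k * f x) * g x ∂μ) =o[atTop] fun k => k ^ p := by
  refine IsBigO.trans_isLittleO (IsBigO.of_bound
    (Real.exp (k₀ * c) * ∫ x in S, ‖Real.exp (-k₀ * f x) * g x‖ ∂μ) ?_)
    (isLittleO_exp_neg_mul_rpow_atTop hc p)
  filter_upwards [eventually_ge_atTop k₀] with k hk
  refine (abs_setIntegral_exp_neg_mul_le hT hTS hfc hint hk).trans (le_of_eq ?_)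
  rw [Real.norm_of_nonneg (Real.exp_nonneg _), mul_right_comm, ← Real.exp_add]
  congr 2
  ring

/-- The substitution `x = P⁻¹ (t z)`, with Jacobian `|det P⁻¹| t ^ d`. Extending the integrand by
zero allows both changes of variables to be made on the whole space. -/
theorem setIntegral_preimage_ball_eq_scaled {d : ℕ} {f g : EuclideanSpace ℝ (Fin d) → ℝ}
    (P : EuclideanSpace ℝ (Fin d) ≃L[ℝ] EuclideanSpace ℝ (Fin d)) (δ : ℝ) {k t : ℝ} (ht : 0 < t)
    (hkt : k = (t ^ 2)⁻¹) :
    ∫ x in P ⁻¹' Metric.ball 0 δ, Real.exp (-k * f x) * g x =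
      |LinearMap.det P.symm.toLinearMap| * (t ^ d *
        ∫ z : EuclideanSpace ℝ (Fin d), {z : EuclideanSpace ℝ (Fin d) | t * ‖z‖ < δ}.indicator
          (fun z => Real.exp (-((f ∘ P.symm) (t • z) / t ^ 2)) * (g ∘ P.symm) (t • z)) z) := by
  have hmeas : MeasurableSet (P ⁻¹' Metric.ball 0 δ) :=
    (Metric.isOpen_ball.preimage P.continuous).measurableSet
  rw [← integral_indicator hmeas, integral_comp_continuousLinearEquiv volume P.symm]
  congr 1
  set ψ : EuclideanSpace ℝ (Fin d) → ℝ := fun y => (P ⁻¹' Metric.ball 0 δ).indicator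
    (fun x => Real.exp (-k * f x) * g x) (P.symm y) with hψ
  have h1 := Measure.integral_comp_smul volume ψ t
  rw [finrank_euclideanSpace_fin, abs_of_pos (by positivity), smul_eq_mul] at h1
  have h2 : ∀ z, {z : EuclideanSpace ℝ (Fin d) | t * ‖z‖ < δ}.indicator
      (fun z => Real.exp (-((f ∘ P.symm) (t • z) / t ^ 2)) * (g ∘ P.symm) (t • z)) z =
      ψ (t • z) := by
    intro z
    have hmem : P.symm (t • z) ∈ P ⁻¹' Metric.ball 0 δ ↔ t * ‖z‖ < δ := by
      rw [Set.mem_preimage, ContinuousLinearEquiv.apply_symm_apply, mem_ball_zero_iff, norm_smul,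
        Real.norm_of_nonneg ht.le]
    by_cases hz : t * ‖z‖ < δ
    · rw [hψ, Set.indicator_of_mem (s := {z : EuclideanSpace ℝ (Fin d) | t * ‖z‖ < δ}) hz]
      simp only
      rw [Set.indicator_of_mem (hmem.2 hz), hkt]
      simp only [Function.comp_apply]
      congr 2
      ring
    · rw [hψ, Set.indicator_of_notMem (s := {z : EuclideanSpace ℝ (Fin d) | t * ‖z‖ < δ}) hz]
      simp only
      rw [Set.indicator_of_notMem (mt hmem.1 hz)]
  simp_rw [h2]
  rw [h1, mul_inv_cancel_left₀ (by positivity)]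

end Integrals

/-! ### Assembly of the expansion -/

open MeasureTheory LaplaceExpansion in
/-- The expansion of the part of the integral near the minimum, with the parameter `t = k ^ (-1/2)`,
together with a neighbourhood of the minimum for which it holds. -/
theorem exists_isLittleO_setIntegral_near_min {d N : ℕ} {R : Set (EuclideanSpace ℝ (Fin d))}
    (h0R : (0 : EuclideanSpace ℝ (Fin d)) ∈ interior R) {f g : EuclideanSpace ℝ (Fin d) → ℝ}
    (hf : ContDiffOn ℝ ((N + 2 : ℕ) : WithTop ℕ∞) f R)
    (hg : ContDiffOn ℝ (N : WithTop ℕ∞) g R) (hf0 : f 0 = 0) (hmin : IsLocalMin f 0)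
    {P : EuclideanSpace ℝ (Fin d) ≃L[ℝ] EuclideanSpace ℝ (Fin d)}
    (hP : hessian (f ∘ P.symm) 0 = 1) :
    ∃ δ > 0, P ⁻¹' Metric.ball 0 δ ⊆ R ∧
      (fun t : ℝ => (∫ x in P ⁻¹' Metric.ball 0 δ, Real.exp (-(t ^ 2)⁻¹ * f x) * g x) -
        t ^ d * ∑ s ∈ Finset.range (N + 1), coeff f g P s * t ^ s)
        =o[𝓝[>] 0] fun t => t ^ (d + N) := by
  have hR0 : R ∈ 𝓝 (P.symm 0) := by
    rw [map_zero]
    exact mem_interior_iff_mem_nhds.1 h0R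
  have hF : ContDiffAt ℝ ((N + 2 : ℕ) : WithTop ℕ∞) (f ∘ P.symm) 0 :=
    (hf.contDiffAt hR0).comp 0 P.symm.contDiff.contDiffAt
  have hG : ContDiffAt ℝ N (g ∘ P.symm) 0 :=
    (hg.contDiffAt hR0).comp 0 P.symm.contDiff.contDiffAt
  have hFmin : IsLocalMin (f ∘ P.symm) 0 := by
    have ht : Tendsto P.symm (𝓝 0) (𝓝 0) := by
      simpa using P.symm.continuous.tendsto 0
    filter_upwards [ht.eventually hmin] with y hy
    simpa using hy
  have hT0 : ∀ z, taylorTerm (f ∘ P.symm) 0 z = 0 := fun z => by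
    rw [taylorTerm_zero, Function.comp_apply, map_zero, hf0]
  have hT1 := taylorTerm_one_of_isLocalMin hFmin
  have hT2 := taylorTerm_two_of_hessian_eq_one hP
  obtain ⟨δ₁, hδ₁, hu⟩ := exists_hasScaledExpansion_div_sq hF hT0 hT1 hT2
  obtain ⟨δ₂, hδ₂, hv⟩ := exists_hasScaledExpansion_smul hG
  obtain ⟨δ₃, hδ₃, hq⟩ := exists_abs_sub_norm_sq_le
    (hF.of_le (by exact_mod_cast Nat.le_add_left 2 N)) hT0 hT1 hT2
  have hev : ∀ᶠ y in 𝓝 (0 : EuclideanSpace ℝ (Fin d)), P.symm y ∈ R :=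
    P.symm.continuous.continuousAt.eventually_mem hR0
  obtain ⟨δ₄, hδ₄, hball⟩ := Metric.eventually_nhds_iff_ball.1 hev
  obtain ⟨δ, hδ, hδle⟩ : ∃ δ > 0, δ ≤ δ₁ ∧ δ ≤ δ₂ ∧ δ ≤ δ₃ ∧ δ ≤ δ₄ :=
    ⟨min (min δ₁ δ₂) (min δ₃ δ₄), by positivity, by simp⟩
  have hmaps : Set.MapsTo P.symm (Metric.ball 0 δ) R := fun y hy =>
    hball y (Metric.ball_subset_ball hδle.2.2.2 hy)
  have hsub : P ⁻¹' Metric.ball 0 δ ⊆ R := fun x hx => by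
    simpa using hmaps hx
  refine ⟨δ, hδ, hsub, ?_⟩
  have hcore := isLittleO_integral_scaled hδ (hf.continuousOn.comp P.symm.continuous.continuousOn hmaps)
    (hg.continuousOn.comp P.symm.continuous.continuousOn hmaps)
    (fun y hy => hq y (Metric.ball_subset_ball hδle.2.2.1 hy)) (hu δ hδle.1) (fun z => by simp)
    (hv δ hδle.2.1)
  -- The Jacobian of `P⁻¹` is the factor `1 / √(det H)` that turns Gaussian integrals into the
  -- coefficients.
  have hcoeff : ∀ s ∈ Finset.range (N + 1), |LinearMap.det P.symm.toLinearMap| *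
      (∫ z : EuclideanSpace ℝ (Fin d), Real.exp (-(‖z‖ ^ 2 / 2)) * PowerSeries.coeff s
        ((PowerSeries.mk fun n => if n = 0 then 0 else
          taylorTerm (f ∘ P.symm) (n + 2) z).expNegMul N
          (PowerSeries.mk fun n => taylorTerm (g ∘ P.symm) n z))) = coeff f g P s := by
    intro s hs
    rw [integral_gaussian_mul_coeff_expNegMul (by have := Finset.mem_range.1 hs; omega) hF hG,
      abs_det_eq_of_hessian_comp_eq_one hP, coeff, ← mul_assoc, inv_mul_eq_div]
  have h1 := (isBigO_refl (fun t : ℝ => t ^ d) (𝓝[>] 0)).mul_isLittleO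
    (hcore.const_mul_left |LinearMap.det P.symm.toLinearMap|)
  refine h1.congr' ?_ (Eventually.of_forall fun t => (pow_add t d N).symm)
  filter_upwards [self_mem_nhdsWithin] with t ht
  rw [setIntegral_preimage_ball_eq_scaled P δ ht rfl, mul_sub, Finset.mul_sum,
    ← Finset.sum_congr rfl fun s hs => congrArg (· * t ^ s) (hcoeff s hs)]
  simp only [mul_assoc]
  ring

theorem theorem1p1 {d N : ℕ} {R : Set (EuclideanSpace ℝ (Fin d))}
    (hR : MeasurableSet R) (h0R : (0 : EuclideanSpace ℝ (Fin d)) ∈ interior R)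
    {f g : EuclideanSpace ℝ (Fin d) → ℝ}
    (hf : ContDiffOn ℝ ((N + 2 : ℕ) : WithTop ℕ∞) f R)
    (hg : ContDiffOn ℝ (N : WithTop ℕ∞) g R)
    -- `f` has a unique minimum on `R`, of value `0`, at `0`, and is otherwise bounded away from `0`
    (hf0 : f 0 = 0)
    (hfpos : ∀ x ∈ R, x ≠ 0 → 0 < f x)
    (hfaway : ∀ δ > 0, ∃ c > 0, ∀ x ∈ R, δ ≤ ‖x‖ → c ≤ f x)
    -- the minimum is nondegenerate
    (hdet : (LaplaceExpansion.hessian f 0).det ≠ 0)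
    {k₀ : ℝ} (hk₀ : 0 < k₀)
    (hint : MeasureTheory.IntegrableOn (fun x => Real.exp (-k₀ * f x) * g x) R
      MeasureTheory.volume) :
    (∀ k ≥ k₀, MeasureTheory.IntegrableOn (fun x => Real.exp (-k * f x) * g x) R
      MeasureTheory.volume) ∧
    -- coordinates `y = P x` in which the Hessian of `f` at `0` is the identity exist
    (∃ P : EuclideanSpace ℝ (Fin d) ≃L[ℝ] EuclideanSpace ℝ (Fin d),
      LaplaceExpansion.hessian (f ∘ P.symm) 0 = 1) ∧
    -- and the expansion holds, with coefficients computed in any such coordinates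
    ∀ P : EuclideanSpace ℝ (Fin d) ≃L[ℝ] EuclideanSpace ℝ (Fin d),
      LaplaceExpansion.hessian (f ∘ P.symm) 0 = 1 →
      (∀ s, Odd s → LaplaceExpansion.coeff f g P s = 0) ∧
      ((fun k : ℝ => (∫ x in R, Real.exp (-k * f x) * g x) -
          k ^ (-(d : ℝ) / 2) * ∑ j ∈ Finset.range (N / 2 + 1),
            LaplaceExpansion.coeff f g P (2 * j) * k ^ (-(j : ℝ)))
        =O[Filter.atTop] fun k : ℝ => k ^ (-((N : ℝ) + d) / 2 + 1)) ∧
      ((fun k : ℝ => (∫ x in R, Real.exp (-k * f x) * g x) -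
          k ^ (-(d : ℝ) / 2) * ∑ j ∈ Finset.range (N / 2 + 1),
            LaplaceExpansion.coeff f g P (2 * j) * k ^ (-(j : ℝ)))
        =o[Filter.atTop] fun k : ℝ => k ^ (-((N : ℝ) + d) / 2)) := by
  have hR0 : R ∈ 𝓝 (0 : EuclideanSpace ℝ (Fin d)) := mem_interior_iff_mem_nhds.1 h0R
  have hnonneg : ∀ x ∈ R, 0 ≤ f x := by
    intro x hx
    rcases eq_or_ne x 0 with rfl | hx0
    · exact hf0.ge
    · exact (hfpos x hx hx0).le
  have hmin : IsLocalMin f 0 := by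
    filter_upwards [hR0] with x hx
    rw [hf0]
    exact hnonneg x hx
  have hintk : ∀ k ≥ k₀, MeasureTheory.IntegrableOn (fun x => Real.exp (-k * f x) * g x) R
      MeasureTheory.volume := fun k hk =>
    integrableOn_exp_neg_mul hR (hf.continuousOn.aestronglyMeasurable hR) hnonneg hint hk
  refine ⟨hintk, exists_hessian_comp_symm_eq_one
    ((hf.contDiffAt hR0).of_le (by exact_mod_cast Nat.le_add_left 2 N)) hf0 hmin hdet,
    fun P hP => ⟨fun s hs => coeff_eq_zero_of_odd f g P hs, ?_⟩⟩
  -- The `o` statement implies the `O` statement, whose comparison function is larger by a factor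
  -- `k`.
  suffices h : (fun k : ℝ => (∫ x in R, Real.exp (-k * f x) * g x) -
      k ^ (-(d : ℝ) / 2) * ∑ j ∈ Finset.range (N / 2 + 1),
        LaplaceExpansion.coeff f g P (2 * j) * k ^ (-(j : ℝ)))
      =o[atTop] fun k : ℝ => k ^ (-((N : ℝ) + d) / 2) by
    refine ⟨h.isBigO.trans (IsBigO.of_bound 1 ?_), h⟩
    filter_upwards [eventually_ge_atTop 1] with k hk
    rw [one_mul, Real.norm_of_nonneg (by positivity), Real.norm_of_nonneg (by positivity)]
    exact Real.rpow_le_rpow_of_exponent_le hk (by linarith)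
  obtain ⟨δ, hδ, hsub, hnear⟩ := exists_isLittleO_setIntegral_near_min h0R hf hg hf0 hmin hP
  set U := P ⁻¹' Metric.ball 0 δ with hU
  have hUo : IsOpen U := Metric.isOpen_ball.preimage P.continuous
  have hU0 : U ∈ 𝓝 (0 : EuclideanSpace ℝ (Fin d)) := hUo.mem_nhds (by simp [hU, hδ])
  obtain ⟨ε, hε, hεU⟩ := Metric.mem_nhds_iff.1 hU0
  obtain ⟨c, hc, hfc⟩ := hfaway ε hε
  -- `U` contains the ball of radius `ε`, so `f ≥ c` on `R \ U`.
  have htail := isLittleO_setIntegral_exp_neg_mul (hR.diff hUo.measurableSet) Set.sdiff_subset hc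
    (fun x hx => hfc x hx.1 (by
      by_contra hlt
      exact hx.2 (hεU (by simpa using hlt)))) hint (-((N : ℝ) + d) / 2)
  have ht : Tendsto (fun k : ℝ => k ^ (-(1 / 2) : ℝ)) atTop (𝓝[>] 0) := by
    rw [tendsto_nhdsWithin_iff]
    refine ⟨tendsto_rpow_neg_atTop (by norm_num), ?_⟩
    filter_upwards [eventually_gt_atTop 0] with k hk
    exact Real.rpow_pos_of_pos hk _
  have hpow : ∀ k : ℝ, 0 < k → ∀ n : ℕ, (k ^ (-(1 / 2) : ℝ)) ^ n = k ^ (-(n : ℝ) / 2) := by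
    intro k hk n
    rw [← Real.rpow_natCast, ← Real.rpow_mul hk.le]
    congr 1
    ring
  refine (htail.add ((hnear.comp_tendsto ht).congr' ?_ ?_)).congr' (f₁ := fun k : ℝ =>
    (∫ x in R \ U, Real.exp (-k * f x) * g x) + ((∫ x in U, Real.exp (-k * f x) * g x) -
      k ^ (-(d : ℝ) / 2) * ∑ j ∈ Finset.range (N / 2 + 1),
        LaplaceExpansion.coeff f g P (2 * j) * k ^ (-(j : ℝ)))) ?_ EventuallyEq.rfl
  · filter_upwards [eventually_gt_atTop 0] with k hk
    have h2 : ((k ^ (-(1 / 2) : ℝ)) ^ 2)⁻¹ = k := by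
      rw [hpow k hk]
      norm_num [Real.rpow_neg_one]
    simp only [Function.comp_apply]
    -- With the odd terms gone, the powers `t ^ (2 j)` become `k ^ (-j)`.
    rw [h2, hpow k hk d, sum_range_eq_sum_even fun s hs => by
      rw [coeff_eq_zero_of_odd f g P hs, zero_mul]]
    congr 2
    refine Finset.sum_congr rfl fun j _ => ?_
    rw [hpow k hk]
    congr 2
    push_cast
    ring
  · filter_upwards [eventually_gt_atTop 0] with k hk
    simp only [Function.comp_apply]
    rw [hpow k hk]
    congr 1
    push_cast
    ring
  -- Splitting the integral over `R` into `U` and `R \ U` needs integrability, which holds from `k₀`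
  -- on.
  · filter_upwards [eventually_ge_atTop k₀] with k hk
    have hsplit := MeasureTheory.setIntegral_sdiff hUo.measurableSet (hintk k hk) hsub
    rw [hsplit]
    ring
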